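/- For a compact set $K\subset\mathbb R^3$ let its Newtonian capacity be $$\mathrm{cap}(K)=\inf\Big\{\int_{\mathbb R^3}|Du|^2:\ u\ge \mathbf 1_K,\ u\in D^1(\mathbb R^3)\cap C^0(\mathbb R^3)\Big\},$$ where $D^1(\mathbb R^3)$ is the set of $f\in L^1_{\mathrm{loc}}(\mathbb R^3)$ with distributional gradient $Df\in L^2(\mathbb R^3)$ which vanish at infinity, i.e. $|\{|f|>\varepsilon\}|<\infty$ for all $\varepsilon>0$. For $K\neq\emptyset$ and $r>0$ let $K_r=\{x:\ \min_{y\in K}|x-y|\le r\}$, let $P(A)\in[0,\infty]$ denote the (De Giorgi) perimeter of a measurable set $A\subset\mathbb R^3$, and let $\tilde K$ be the union of $K$ and all bounded connected components of $\mathbb R^3\setminus K$. Integrals and reciprocals are taken in $[0,\infty]$. Let $\alpha>0$ and $$K(\alpha)=\Big(\bigcup_{n\ge 1}\{(n^{-\alpha},0)\}\cup\{(0,0)\}\Big)\times[0,1]\subset\mathbb R^3 .$$ (i) $K(\alpha)$ is a compact subset of $[0,1]^3$ with $\mathrm{cap}(K(\alpha))=0$. (ii) The function $r\mapsto P(K(\alpha)_r)^{-1}$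 is Lebesgue measurable on $(0,\infty)$, and $$\Big(\int_{(0,\infty)}P(K(\alpha)_r)^{-1}\,dr\Big)^{-1}\ \ge\ \frac{4\pi\alpha}{2^{\alpha+2}+3\alpha(\alpha+1)}\ >\ 0 .$$ In addition $\widetilde{K(\alpha)}=K(\alpha)$. Consequently the upper bound $$\mathrm{cap}(K)\le\Big(\int_{(0,\infty)}P(\tilde K_t)^{-1}\,dt\Big)^{-1},$$ for non-empty compact $K$ for which the integral is finite, need not be sharp: for $K=K(\alpha)$ the integral is finite and the inequality is strict. -/

import Mathlib

open MeasureTheory Set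
open scoped ENNReal

noncomputable section

/-- Euclidean space of dimension `d`. -/
abbrev Euc (d : ℕ) : Type := EuclideanSpace ℝ (Fin d)

/-- `g` is the distributional gradient of `u`: integration by parts holds against every smooth
compactly supported test function, in every direction. -/
def IsWeakGradient {d : ℕ} (u : Euc d → ℝ) (g : Euc d → Euc d) : Prop :=
  ∀ φ : Euc d → ℝ, ContDiff ℝ (⊤ : ℕ∞) φ → HasCompactSupport φ → ∀ v : Euc d,
    ∫ x, u x * fderiv ℝ φ x v = -∫ x, inner ℝ (g x) v * φ x

/-- `u` belongs to the space `D¹` of locally integrable functions which vanish at infinity and have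
a square integrable distributional gradient, and `g` is (a representative of) that gradient. -/
structure IsD1WithGradient {d : ℕ} (u : Euc d → ℝ) (g : Euc d → Euc d) : Prop where
  locallyIntegrable : LocallyIntegrable u
  weakGradient : IsWeakGradient u g
  memLp : MemLp g 2
  vanishing : ∀ ε : ℝ, 0 < ε → volume {x | ε < |u x|} < ⊤

/-- The Newtonian capacity of `K`: the infimum of the Dirichlet integrals of all continuous
functions in `D¹` which dominate the indicator function of `K`. -/
def newtonianCapacity {d : ℕ} (K : Set (Euc d)) : ℝ≥0∞ :=
  sInf {c | ∃ (u : Euc d → ℝ) (g : Euc d → Euc d), IsD1WithGradient u g ∧ Continuous u ∧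
    (∀ x, K.indicator (fun _ => (1 : ℝ)) x ≤ u x) ∧ c = ∫⁻ x, ‖g x‖ₑ ^ 2}

/-- The divergence of a vector field. -/
def divergence {d : ℕ} (φ : Euc d → Euc d) (x : Euc d) : ℝ :=
  ∑ i : Fin d, fderiv ℝ φ x (EuclideanSpace.single i 1) i

/-- The (De Giorgi) perimeter of a measurable set: the supremum of the integrals over `A` of the
divergences of all `C¹` compactly supported vector fields of norm at most `1`. -/
def perimeter {d : ℕ} (A : Set (Euc d)) : ℝ≥0∞ :=
  ⨆ (φ : Euc d → Euc d) (_ : ContDiff ℝ 1 φ ∧ HasCompactSupport φ ∧ ∀ x, ‖φ x‖ ≤ 1),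
    ENNReal.ofReal (∫ x in A, divergence φ x)

/-- The integral `∫₀^∞ P(K_r)⁻¹ dr`, where `K_r` is the closed `r`-neighbourhood of `K`. -/
def invPerimeterIntegral {d : ℕ} (K : Set (Euc d)) : ℝ≥0∞ :=
  ∫⁻ r in Ioi (0 : ℝ), (perimeter (Metric.cthickening r K))⁻¹

/-- The union of `K` and all bounded connected components of its complement. -/
def filledHull {d : ℕ} (K : Set (Euc d)) : Set (Euc d) :=
  K ∪ {x | x ∈ Kᶜ ∧ Bornology.IsBounded (connectedComponentIn Kᶜ x)}

/-- The set `({(n^(-α), 0) : n = 1, 2, …} ∪ {(0, 0)}) × [0, 1]` in three-dimensional space. -/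
def segmentSet (α : ℝ) : Set (Euc 3) :=
  {x | ((∃ n : ℕ, 1 ≤ n ∧ x 0 = (n : ℝ) ^ (-α)) ∨ x 0 = 0) ∧ x 1 = 0 ∧ x 2 ∈ Icc (0 : ℝ) 1}

end

/-! The perimeter is bounded below in two ways by testing its definition with regularized radial
fields. Since `segmentSet α` contains the origin, its `r`-neighbourhood contains a ball of radius
`r`, so its perimeter is at least `4πr²`; this makes the reciprocal integrable at infinity. For
small `r`, consecutive segments are separated by `n^(-α) - (n+1)^(-α) ≥ α (n+1)^(-(α+1))`. Hence
about `T = (α/(2r))^(1/(α+1))` of the tubes around single segments are disjoint from one another and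
from the rest. Perimeter is superadditive over disjoint compact sets and each tube contributes at
least `2πr`, so the perimeter is at least a constant times `r^(α/(α+1))`, and the reciprocal is
integrable at `0`. The key lemmas are `perimeter_add_le_union`,
`perimeter_cthickening_segmentTail_ge` and `invPerimeterIntegral_segmentSet_le`.

The capacity vanishes because a segment in space can be dominated at arbitrarily small energy
(`hasEnergyLE_unitSegment`). The function that dominates the limit segment also dominates, by
continuity, all but finitely many of the others, and a finite union costs arbitrarily little energy
(`hasEnergyLE_segmentSet`). Thus zero lies strictly below the reciprocal of a finite integral. -/

/-! ### Cutoffs, calibrations and superadditivity of the perimeter -/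

open Filter Topology in
/-- A smooth cutoff function equal to `1` near a compact set and supported in a given open set. -/
theorem exists_smooth_cutoff {d : ℕ} {A U : Set (Euc d)} (hA : IsCompact A) (hU : IsOpen U)
    (hAU : A ⊆ U) :
    ∃ χ : Euc d → ℝ, ContDiff ℝ (⊤ : ℕ∞) χ ∧ HasCompactSupport χ ∧ Function.support χ ⊆ U ∧
      (∀ x, χ x ∈ Icc (0 : ℝ) 1) ∧ ∀ x ∈ A, χ =ᶠ[𝓝 x] fun _ => 1 := by
  obtain ⟨δ, hδ, hδU⟩ := hA.exists_cthickening_subset_open hU hAU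
  have hδ2 : 0 < δ / 2 := half_pos hδ
  -- The two radii `δ/2 < δ` make `χ` equal to `1` on a neighbourhood of `A`, so that multiplying by
  -- `χ` changes no derivative on `A`.
  obtain ⟨χ, h1, h2, h3, h4⟩ := exists_contMDiff_support_eq_eq_one_iff
    (modelWithCornersSelf ℝ (Euc d)) (n := (⊤ : ℕ∞)) (s := Metric.thickening δ A)
    (t := Metric.cthickening (δ / 2) A) Metric.isOpen_thickening Metric.isClosed_cthickening
    (Metric.cthickening_subset_thickening' hδ (half_lt_self hδ) A)
  refine ⟨χ, h1.contDiff, ?_, ?_, fun x => h2 (mem_range_self x), fun x hx => ?_⟩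
  · refine HasCompactSupport.of_support_subset_isCompact (hA.cthickening (r := δ)) ?_
    rw [h3]
    exact Metric.thickening_subset_cthickening _ _
  · rw [h3]
    exact (Metric.thickening_subset_cthickening _ _).trans hδU
  · have : Metric.thickening (δ / 2) A ∈ 𝓝 x :=
      Metric.isOpen_thickening.mem_nhds (Metric.self_subset_thickening hδ2 A hx)
    filter_upwards [this] with y hy
    exact (h4 y).1 (Metric.thickening_subset_cthickening _ _ hy)

open Filter Topology in
theorem divergence_congr {d : ℕ} {φ ψ : Euc d → Euc d} {x : Euc d} (h : φ =ᶠ[𝓝 x] ψ) :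
    divergence φ x = divergence ψ x := by
  simp only [divergence, h.fderiv_eq]

theorem continuous_divergence {d : ℕ} {φ : Euc d → Euc d} (h : ContDiff ℝ 1 φ) :
    Continuous (divergence φ) := by
  have h1 : Continuous (fderiv ℝ φ) := h.continuous_fderiv one_ne_zero
  unfold divergence
  fun_prop

theorem hasCompactSupport_divergence {d : ℕ} {φ : Euc d → Euc d} (h : HasCompactSupport φ) :
    HasCompactSupport (divergence φ) := by
  refine (h.fderiv (𝕜 := ℝ)).mono fun x hx h0 => hx ?_
  rw [divergence, h0]
  simp

theorem le_perimeter {d : ℕ} {A : Set (Euc d)} {φ : Euc d → Euc d} (h : ContDiff ℝ 1 φ)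
    (hc : HasCompactSupport φ) (hn : ∀ x, ‖φ x‖ ≤ 1) :
    ENNReal.ofReal (∫ x in A, divergence φ x) ≤ perimeter A :=
  le_iSup₂ (f := fun (φ : Euc d → Euc d)
    (_ : ContDiff ℝ 1 φ ∧ HasCompactSupport φ ∧ ∀ x, ‖φ x‖ ≤ 1) =>
    ENNReal.ofReal (∫ x in A, divergence φ x)) φ ⟨h, hc, hn⟩

/-- For compact sets, fields which are not compactly supported may be used as calibrations. -/
theorem le_perimeter_of_isCompact {d : ℕ} {A : Set (Euc d)} (hA : IsCompact A)
    {φ : Euc d → Euc d} (h : ContDiff ℝ 1 φ) (hn : ∀ x, ‖φ x‖ ≤ 1) :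
    ENNReal.ofReal (∫ x in A, divergence φ x) ≤ perimeter A := by
  obtain ⟨χ, h1, h2, -, h3, h4⟩ := exists_smooth_cutoff hA isOpen_univ (subset_univ A)
  have h1' : ContDiff ℝ 1 χ := h1.of_le (by exact_mod_cast le_top)
  have := le_perimeter (A := A) (φ := fun x => χ x • φ x) (h1'.smul h) (h2.smul_right) (fun x => by
    rw [norm_smul, Real.norm_of_nonneg (h3 x).1]
    exact mul_le_one₀ (h3 x).2 (norm_nonneg _) (hn x))
  convert this using 2
  refine setIntegral_congr_fun hA.measurableSet fun x hx => divergence_congr ?_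
  filter_upwards [h4 x hx] with y hy
  simp [hy]

/-- The perimeter is superadditive on disjoint compact sets. -/
theorem perimeter_add_le_union {d : ℕ} {A B : Set (Euc d)} (hA : IsCompact A) (hB : IsCompact B)
    (hd : Disjoint A B) : perimeter A + perimeter B ≤ perimeter (A ∪ B) := by
  obtain ⟨U, V, hU, hV, hAU, hBV, hUV⟩ := SeparatedNhds.of_isCompact_isCompact hA hB hd
  obtain ⟨χ, h1, h2, hs, h3, h4⟩ := exists_smooth_cutoff hA hU hAU
  obtain ⟨η, k1, k2, ks, k3, k4⟩ := exists_smooth_cutoff hB hV hBV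
  have h1' : ContDiff ℝ 1 χ := h1.of_le (by exact_mod_cast le_top)
  have k1' : ContDiff ℝ 1 η := k1.of_le (by exact_mod_cast le_top)
  have hχ : ∀ x ∉ U, χ x = 0 := fun x hx => by
    by_contra h; exact hx (hs h)
  have hη : ∀ x ∉ V, η x = 0 := fun x hx => by
    by_contra h; exact hx (ks h)
  have hint : ∀ (C : Set (Euc d)) {ζ : Euc d → Euc d}, ContDiff ℝ 1 ζ → HasCompactSupport ζ →
      IntegrableOn (divergence ζ) C := fun C ζ a b =>
    ((continuous_divergence a).integrable_of_hasCompactSupport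
      (hasCompactSupport_divergence b)).integrableOn
  have key : ∀ φ ψ : Euc d → Euc d, (ContDiff ℝ 1 φ ∧ HasCompactSupport φ ∧ ∀ x, ‖φ x‖ ≤ 1) →
      (ContDiff ℝ 1 ψ ∧ HasCompactSupport ψ ∧ ∀ x, ‖ψ x‖ ≤ 1) →
      ENNReal.ofReal ((∫ x in A, divergence φ x) + ∫ x in B, divergence ψ x) ≤
        perimeter (A ∪ B) := by
    intro φ ψ hφ hψ
    -- The cutoffs live in disjoint open sets, so at each point at most one summand survives and the
    -- norm bound is kept.
    set ζ : Euc d → Euc d := fun x => χ x • φ x + η x • ψ x with hζ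
    have c1 : ContDiff ℝ 1 ζ := (h1'.smul hφ.1).add (k1'.smul hψ.1)
    have c2 : HasCompactSupport ζ := (h2.smul_right).add (k2.smul_right)
    have c3 : ∀ x, ‖ζ x‖ ≤ 1 := fun x => by
      by_cases hx : x ∈ U
      · have : x ∉ V := fun h => hUV.le_bot ⟨hx, h⟩
        simp only [hζ, hη x this, zero_smul, add_zero, norm_smul, Real.norm_of_nonneg (h3 x).1]
        exact mul_le_one₀ (h3 x).2 (norm_nonneg _) (hφ.2.2 x)
      · simp only [hζ, hχ x hx, zero_smul, zero_add, norm_smul, Real.norm_of_nonneg (k3 x).1]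
        exact mul_le_one₀ (k3 x).2 (norm_nonneg _) (hψ.2.2 x)
    have eA : ∫ x in A, divergence φ x = ∫ x in A, divergence ζ x := by
      refine setIntegral_congr_fun hA.measurableSet fun x hx => divergence_congr ?_
      filter_upwards [h4 x hx, hU.mem_nhds (hAU hx)] with y hy hyU
      have : y ∉ V := fun h => hUV.le_bot ⟨hyU, h⟩
      simp [hζ, hy, hη y this]
    have eB : ∫ x in B, divergence ψ x = ∫ x in B, divergence ζ x := by
      refine setIntegral_congr_fun hB.measurableSet fun x hx => divergence_congr ?_
      filter_upwards [k4 x hx, hV.mem_nhds (hBV hx)] with y hy hyV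
      have : y ∉ U := fun h => hUV.le_bot ⟨h, hyV⟩
      simp [hζ, hy, hχ y this]
    rw [eA, eB, ← setIntegral_union hd hB.measurableSet (hint A c1 c2) (hint B c1 c2)]
    exact le_perimeter c1 c2 c3
  have z : ContDiff ℝ 1 (0 : Euc d → Euc d) ∧ HasCompactSupport (0 : Euc d → Euc d) ∧
      ∀ x, ‖(0 : Euc d → Euc d) x‖ ≤ 1 := ⟨contDiff_const, HasCompactSupport.zero, by simp⟩
  have dz : ∀ C : Set (Euc d), ∫ x in C, divergence (0 : Euc d → Euc d) x = 0 := fun C => by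
    simp [divergence]
  refine ENNReal.biSup_add_biSup_le' ⟨0, z⟩ ⟨0, z⟩ fun φ hφ ψ hψ => ?_
  -- `ENNReal.ofReal` truncates negative integrals, so a field with a negative integral is replaced
  -- by the zero field.
  rcases le_total (∫ x in A, divergence φ x) 0 with ha | ha
  · rw [ENNReal.ofReal_of_nonpos ha, zero_add]
    simpa [dz] using key 0 ψ z hψ
  rcases le_total (∫ x in B, divergence ψ x) 0 with hb | hb
  · rw [ENNReal.ofReal_of_nonpos hb, add_zero]
    simpa [dz] using key φ 0 hφ z
  rw [← ENNReal.ofReal_add ha hb]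
  exact key φ ψ hφ hψ

/-- A field of nonnegative divergence calibrates every compact set against its subsets. -/
theorem le_perimeter_of_subset {d : ℕ} {A B : Set (Euc d)} (hA : IsCompact A)
    (hBA : B ⊆ A) {φ : Euc d → Euc d} (h : ContDiff ℝ 1 φ) (hn : ∀ x, ‖φ x‖ ≤ 1)
    (hdiv : ∀ x, 0 ≤ divergence φ x) :
    ENNReal.ofReal (∫ x in B, divergence φ x) ≤ perimeter A :=
  (ENNReal.ofReal_le_ofReal (setIntegral_mono_set
    ((continuous_divergence h).continuousOn.integrableOn_compact hA)
    (Filter.Eventually.of_forall hdiv) hBA.eventuallyLE)).trans (le_perimeter_of_isCompact hA h hn)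

/-! ### Radial fields and the resulting perimeter bounds -/

theorem divergence_eq_sum_lineDeriv {d : ℕ} {φ : Euc d → Euc d} {x : Euc d}
    (h : DifferentiableAt ℝ φ x) :
    divergence φ x =
      ∑ i, lineDeriv ℝ (fun y => φ y i) x (EuclideanSpace.single i (1 : ℝ)) := by
  unfold divergence
  refine Finset.sum_congr rfl fun i _ => ?_
  have h1 : HasFDerivAt (fun y => φ y i)
      ((EuclideanSpace.proj i : Euc d →L[ℝ] ℝ).comp (fderiv ℝ φ x)) x :=
    (EuclideanSpace.proj i : Euc d →L[ℝ] ℝ).hasFDerivAt.comp x h.hasFDerivAt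
  rw [h1.differentiableAt.lineDeriv_eq_fderiv, h1.fderiv]
  rfl

/-- The squared distance to `p`, measured in the coordinates in `J` only. -/
noncomputable def coordDistSq {d : ℕ} (J : Finset (Fin d)) (p x : Euc d) : ℝ :=
  ∑ j ∈ J, (x j - p j) ^ 2

theorem coordDistSq_nonneg {d : ℕ} (J : Finset (Fin d)) (p x : Euc d) : 0 ≤ coordDistSq J p x :=
  Finset.sum_nonneg fun _ _ => sq_nonneg _

/-- A regularization of the gradient of the distance to `p` in the coordinates in `J`. -/
noncomputable def radialField {d : ℕ} (J : Finset (Fin d)) (p : Euc d) (ε : ℝ) (x : Euc d) :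
    Euc d :=
  WithLp.toLp 2 fun i => if i ∈ J then (x i - p i) / √(coordDistSq J p x + ε ^ 2) else 0

theorem contDiff_radialField {d : ℕ} (J : Finset (Fin d)) (p : Euc d) {ε : ℝ} (hε : ε ≠ 0) :
    ContDiff ℝ 1 (radialField J p ε) := by
  have hq : ∀ x, 0 < coordDistSq J p x + ε ^ 2 := fun x =>
    add_pos_of_nonneg_of_pos (coordDistSq_nonneg J p x) (by positivity)
  rw [contDiff_euclidean]
  intro i
  unfold radialField
  by_cases hi : i ∈ J
  · simp only [hi, if_true]
    refine ContDiff.div (by fun_prop) (ContDiff.sqrt ?_ fun x => (hq x).ne')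
      fun x => (Real.sqrt_pos.2 (hq x)).ne'
    unfold coordDistSq
    fun_prop
  · simp only [hi, if_false]
    exact contDiff_const

theorem norm_radialField_le_one {d : ℕ} (J : Finset (Fin d)) (p : Euc d) (ε : ℝ) (x : Euc d) :
    ‖radialField J p ε x‖ ≤ 1 := by
  have h0 := coordDistSq_nonneg J p x
  rw [EuclideanSpace.norm_eq, Real.sqrt_le_one]
  have : ∀ i, ‖radialField J p ε x i‖ ^ 2 =
      if i ∈ J then (x i - p i) ^ 2 / (coordDistSq J p x + ε ^ 2) else 0 := fun i => by
    by_cases hi : i ∈ J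
    · simp [radialField, hi, div_pow, Real.sq_sqrt (add_nonneg h0 (sq_nonneg ε))]
    · simp [radialField, hi]
  simp only [this, Finset.sum_ite_mem, Finset.univ_inter]
  rw [← Finset.sum_div]
  exact div_le_one_of_le₀ (le_add_of_nonneg_right (sq_nonneg ε)) (add_nonneg h0 (sq_nonneg ε))

theorem hasDerivAt_div_sqrt (u : ℝ) {c : ℝ} (hc : 0 < c) :
    HasDerivAt (fun t => (u + t) / √((u + t) ^ 2 + c)) (c / √(u ^ 2 + c) ^ 3) 0 := by
  have h1 : HasDerivAt (fun t : ℝ => u + t) 1 0 := (hasDerivAt_id 0).const_add u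
  have hp : 0 < u ^ 2 + c := by positivity
  have h2 := h1.div (((h1.pow 2).add_const c).sqrt (by simpa using hp.ne'))
    (by simpa using (Real.sqrt_pos.2 hp).ne')
  refine h2.congr_deriv ?_
  have hs : 0 < √(u ^ 2 + c) := Real.sqrt_pos.2 hp
  have hs2 : √(u ^ 2 + c) ^ 2 = u ^ 2 + c := Real.sq_sqrt hp.le
  simp only [add_zero, Pi.pow_apply]
  rw [div_eq_div_iff (by positivity) (by positivity)]
  field_simp
  norm_num
  linear_combination 2 * hs2

theorem divergence_radialField {d : ℕ} (J : Finset (Fin d)) (p : Euc d) {ε : ℝ} (hε : ε ≠ 0)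
    (x : Euc d) :
    divergence (radialField J p ε) x = ((J.card - 1) * coordDistSq J p x + J.card * ε ^ 2) /
      √(coordDistSq J p x + ε ^ 2) ^ 3 := by
  have hd := ((contDiff_radialField J p hε).differentiable one_ne_zero) x
  rw [divergence_eq_sum_lineDeriv hd]
  have key : ∀ i, lineDeriv ℝ (fun y => radialField J p ε y i) x
      (EuclideanSpace.single i (1 : ℝ)) = if i ∈ J then
        (coordDistSq J p x - (x i - p i) ^ 2 + ε ^ 2) / √(coordDistSq J p x + ε ^ 2) ^ 3 else 0 := by
    intro i
    by_cases hi : i ∈ J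
    · have hc : 0 < ∑ j ∈ J.erase i, (x j - p j) ^ 2 + ε ^ 2 :=
        add_pos_of_nonneg_of_pos (Finset.sum_nonneg fun _ _ => sq_nonneg _) (by positivity)
      have hsum : coordDistSq J p x = (x i - p i) ^ 2 + ∑ j ∈ J.erase i, (x j - p j) ^ 2 :=
        (Finset.add_sum_erase _ _ hi).symm
      have := (hasDerivAt_div_sqrt (x i - p i) hc).deriv
      rw [← add_assoc, ← hsum] at this
      simp only [hi, if_true]
      rw [show coordDistSq J p x - (x i - p i) ^ 2 + ε ^ 2 =
        ∑ j ∈ J.erase i, (x j - p j) ^ 2 + ε ^ 2 by rw [hsum]; ring, ← this, lineDeriv]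
      congr 1
      funext t
      simp only [radialField, hi, if_true, coordDistSq]
      rw [← Finset.add_sum_erase _ _ hi]
      have : ∑ j ∈ J.erase i, ((x + t • EuclideanSpace.single i (1 : ℝ)) j - p j) ^ 2 =
          ∑ j ∈ J.erase i, (x j - p j) ^ 2 :=
        Finset.sum_congr rfl fun j hj => by simp [Finset.ne_of_mem_erase hj]
      rw [this]
      simp only [PiLp.add_apply, PiLp.smul_apply, PiLp.single_apply, if_true, smul_eq_mul,
        mul_one]
      rw [add_sub_right_comm, add_assoc]
    · simp [radialField, hi, lineDeriv]
  simp only [key, Finset.sum_ite_mem, Finset.univ_inter]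
  rw [← Finset.sum_div, Finset.sum_add_distrib, Finset.sum_sub_distrib]
  simp only [Finset.sum_const, nsmul_eq_mul]
  congr 1
  unfold coordDistSq
  ring

/-- This sign lets a ball or cylinder inside `A` bound the perimeter of `A`: enlarging the domain of
integration only increases the integral. -/
theorem divergence_radialField_nonneg {d : ℕ} {J : Finset (Fin d)} (hJ : J.Nonempty) (p : Euc d)
    {ε : ℝ} (hε : ε ≠ 0) (x : Euc d) : 0 ≤ divergence (radialField J p ε) x := by
  rw [divergence_radialField J p hε]
  have h1 : (1 : ℝ) ≤ J.card := by exact_mod_cast hJ.card_pos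
  have := coordDistSq_nonneg J p x
  have := mul_nonneg (sub_nonneg.2 h1) this
  positivity

theorem hasDerivAt_pow_div_sqrt {n : ℕ} (t : ℝ) {ε : ℝ} (hε : ε ≠ 0) :
    HasDerivAt (fun t => t ^ (n + 1) / √(t ^ 2 + ε ^ 2))
      (t ^ n * ((n * t ^ 2 + (n + 1) * ε ^ 2) / √(t ^ 2 + ε ^ 2) ^ 3)) t := by
  have hp : 0 < t ^ 2 + ε ^ 2 := by positivity
  have h2 := (hasDerivAt_pow (n + 1) t).div (((hasDerivAt_pow 2 t).add_const (ε ^ 2)).sqrt hp.ne')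
    (Real.sqrt_pos.2 hp).ne'
  refine h2.congr_deriv ?_
  have hs : 0 < √(t ^ 2 + ε ^ 2) := Real.sqrt_pos.2 hp
  have hs2 : √(t ^ 2 + ε ^ 2) ^ 2 = t ^ 2 + ε ^ 2 := Real.sq_sqrt hp.le
  simp only [Nat.add_sub_cancel]
  push_cast
  field_simp
  rw [hs2]
  ring

/-- The divergence theorem in polar form: the integrand is `t^n` times the divergence of a radial
field in `n + 1` coordinates, and the right side is its flux through radius `r` up to the area
constant. It serves cylinders (`n = 1`) and balls (`n = 2`). -/
theorem integral_flux {n : ℕ} {ε : ℝ} (hε : ε ≠ 0) {r : ℝ} :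
    ∫ t in (0 : ℝ)..r, t ^ n * ((n * t ^ 2 + (n + 1) * ε ^ 2) / √(t ^ 2 + ε ^ 2) ^ 3) =
      r ^ (n + 1) / √(r ^ 2 + ε ^ 2) := by
  rw [intervalIntegral.integral_eq_sub_of_hasDerivAt
    (f := fun t => t ^ (n + 1) / √(t ^ 2 + ε ^ 2)) (fun t _ => hasDerivAt_pow_div_sqrt t hε)]
  · simp
  · refine Continuous.intervalIntegrable ?_ _ _
    refine Continuous.mul (by fun_prop) (Continuous.div (by fun_prop) (by fun_prop) fun t => ?_)
    have : 0 < √(t ^ 2 + ε ^ 2) := Real.sqrt_pos.2 (by positivity)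
    positivity

/-- Integration over a solid cylinder of a function of the squared distance to its axis. -/
theorem setIntegral_cylinder (p : Euc 3) {R a b : ℝ} (hR : 0 ≤ R) (hab : a ≤ b) (G : ℝ → ℝ) :
    ∫ x in {x : Euc 3 | coordDistSq {0, 1} p x ≤ R ^ 2 ∧ x 2 ∈ Icc a b},
      G (coordDistSq {0, 1} p x) = (b - a) * (2 * Real.pi * ∫ t in (0 : ℝ)..R, t * G (t ^ 2)) := by
  -- Extending by zero beyond `R ^ 2` gives an integrand on the whole plane, to which translation
  -- invariance and polar coordinates apply.
  set F : ℝ → ℝ := fun s => if s ≤ R ^ 2 then G s else 0 with hF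
  have hm : MeasurableSet {x : Euc 3 | coordDistSq {0, 1} p x ≤ R ^ 2 ∧ x 2 ∈ Icc a b} := by
    unfold coordDistSq
    exact (measurableSet_le (by fun_prop : Measurable fun x : Euc 3 =>
      ∑ j ∈ {0, 1}, (x j - p j) ^ 2) measurable_const).inter
      (measurableSet_Icc.preimage (by fun_prop : Measurable fun x : Euc 3 => x 2))
  rw [← integral_indicator hm]
  have e1 : ∀ x : Euc 3, indicator {x : Euc 3 | coordDistSq {0, 1} p x ≤ R ^ 2 ∧ x 2 ∈ Icc a b}
      (fun x => G (coordDistSq {0, 1} p x)) x =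
      indicator (Icc a b) 1 (x 2) * F ((x 0 - p 0) ^ 2 + (x 1 - p 1) ^ 2) := fun x => by
    have : coordDistSq {0, 1} p x = (x 0 - p 0) ^ 2 + (x 1 - p 1) ^ 2 := by
      simp [coordDistSq]
    simp only [indicator, mem_ofPred_eq, this, hF]
    split_ifs <;> simp_all
  simp only [e1]
  have v1 := (EuclideanSpace.volume_preserving_symm_measurableEquiv_toLp (Fin 3))
  have v2 := volume_preserving_piFinSuccAbove (fun _ : Fin 3 => ℝ) 2
  have s1 : ∫ x : Euc 3, indicator (Icc a b) 1 (x 2) * F ((x 0 - p 0) ^ 2 + (x 1 - p 1) ^ 2) =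
      ∫ y : ℝ × (Fin 2 → ℝ), indicator (Icc a b) 1 y.1 *
        F ((y.2 0 - p 0) ^ 2 + (y.2 1 - p 1) ^ 2) := by
    rw [← (v2.comp v1).integral_comp ((MeasurableEquiv.measurableEmbedding _).comp
      (MeasurableEquiv.measurableEmbedding _))]
    rfl
  rw [s1, Measure.volume_eq_prod, integral_prod_mul (indicator (Icc a b) 1)
    (fun y : Fin 2 → ℝ => F ((y 0 - p 0) ^ 2 + (y 1 - p 1) ^ 2))]
  congr 1
  · rw [integral_indicator measurableSet_Icc]
    simp [hab]
  have s2 : ∫ y : Fin 2 → ℝ, F ((y 0 - p 0) ^ 2 + (y 1 - p 1) ^ 2) =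
      ∫ y : ℝ × ℝ, F ((y.1 - p 0) ^ 2 + (y.2 - p 1) ^ 2) := by
    rw [← (volume_preserving_finTwoArrow ℝ).integral_comp (MeasurableEquiv.measurableEmbedding _)]
    rfl
  have s5 : ∫ y : ℝ × ℝ, F ((y.1 - p 0) ^ 2 + (y.2 - p 1) ^ 2) =
      ∫ y : ℝ × ℝ, F (y.1 ^ 2 + y.2 ^ 2) :=
    integral_sub_right_eq_self (fun y : ℝ × ℝ => F (y.1 ^ 2 + y.2 ^ 2)) (p 0, p 1)
  rw [s2, s5, ← integral_comp_polarCoord_symm]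
  have s3 : ∀ y : ℝ × ℝ, y.1 • F ((polarCoord.symm y).1 ^ 2 + (polarCoord.symm y).2 ^ 2) =
      (y.1 * F (y.1 ^ 2)) * 1 := fun y => by
    simp only [polarCoord_symm_apply, smul_eq_mul, mul_one]
    congr 2
    linear_combination y.1 ^ 2 * Real.sin_sq_add_cos_sq y.2
  simp only [s3]
  rw [polarCoord_target, Measure.volume_eq_prod,
    setIntegral_prod_mul (fun t => t * F (t ^ 2)) (fun _ => (1 : ℝ))]
  have s4 : ∫ t in Ioi (0 : ℝ), t * F (t ^ 2) = ∫ t in (0 : ℝ)..R, t * G (t ^ 2) := by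
    rw [intervalIntegral.integral_of_le hR, ← Ioi_inter_Iic, ← setIntegral_indicator measurableSet_Iic]
    refine setIntegral_congr_fun measurableSet_Ioi fun t ht => ?_
    have : t ^ 2 ≤ R ^ 2 ↔ t ≤ R := sq_le_sq₀ (le_of_lt ht) hR
    simp only [hF, indicator, mem_Iic, this]
    split_ifs <;> simp
  rw [s4]
  simp [← two_mul, max_eq_left Real.two_pi_pos.le]
  ring

-- Removing the regularization recovers the exact area.
open Filter Topology in
theorem tendsto_mul_pow_div_sqrt (c : ℝ) (n : ℕ) {r : ℝ} (hr : 0 < r) :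
    Tendsto (fun ε => ENNReal.ofReal (c * (r ^ (n + 1) / √(r ^ 2 + ε ^ 2)))) (𝓝[>] 0)
      (𝓝 (ENNReal.ofReal (c * r ^ n))) := by
  have : ContinuousAt (fun ε => ENNReal.ofReal (c * (r ^ (n + 1) / √(r ^ 2 + ε ^ 2)))) 0 := by
    refine ENNReal.continuous_ofReal.continuousAt.comp ?_
    refine ContinuousAt.mul (by fun_prop) (ContinuousAt.div (by fun_prop) (by fun_prop) ?_)
    simpa using (Real.sqrt_pos.2 (pow_pos hr 2)).ne'
  have h := this.tendsto.mono_left (nhdsWithin_le_nhds (s := Ioi 0))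
  convert h using 3
  rw [zero_pow two_ne_zero, add_zero, Real.sqrt_sq hr.le, pow_succ, mul_div_cancel_right₀ _ hr.ne']

/-- A compact set which contains a cylinder of height one has at least the lateral area of the
cylinder as its perimeter. -/
theorem perimeter_ge_of_cylinder_subset {A : Set (Euc 3)} (hA : IsCompact A) {r : ℝ} (hr : 0 < r)
    (p : Euc 3) (h : {x : Euc 3 | coordDistSq {0, 1} p x ≤ r ^ 2 ∧ x 2 ∈ Icc (0 : ℝ) 1} ⊆ A) :
    ENNReal.ofReal (2 * Real.pi * r) ≤ perimeter A := by
  have := tendsto_mul_pow_div_sqrt (2 * Real.pi) 1 hr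
  rw [pow_one] at this
  refine le_of_tendsto this ?_
  filter_upwards [self_mem_nhdsWithin] with ε (hε : 0 < ε)
  have key := le_perimeter_of_subset hA h (contDiff_radialField {0, 1} p hε.ne')
    (norm_radialField_le_one _ p ε) (divergence_radialField_nonneg (by simp) p hε.ne')
  simp only [divergence_radialField _ p hε.ne'] at key
  rw [setIntegral_cylinder p hr.le zero_le_one (fun s =>
    ((({0, 1} : Finset (Fin 3)).card - 1) * s + ({0, 1} : Finset (Fin 3)).card * ε ^ 2) /
      √(s + ε ^ 2) ^ 3)] at key
  refine (le_of_eq (congrArg _ ?_)).trans key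
  rw [sub_zero, one_mul, ← integral_flux hε.ne']
  congr 2
  ext t
  norm_num

/-- A weak form of the isoperimetric inequality: the perimeter of a compact set is at least the
area of every sphere which bounds a ball contained in it. -/
theorem perimeter_ge_of_closedBall_subset {A : Set (Euc 3)} (hA : IsCompact A) {r : ℝ} (hr : 0 < r)
    (h : Metric.closedBall 0 r ⊆ A) :
    ENNReal.ofReal (4 * Real.pi * r ^ 2) ≤ perimeter A := by
  refine le_of_tendsto (tendsto_mul_pow_div_sqrt (4 * Real.pi) 2 hr) ?_
  filter_upwards [self_mem_nhdsWithin] with ε (hε : 0 < ε)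
  have key := le_perimeter_of_subset hA h (contDiff_radialField Finset.univ 0 hε.ne')
    (norm_radialField_le_one _ 0 ε) (divergence_radialField_nonneg (by simp) 0 hε.ne')
  simp only [divergence_radialField _ (0 : Euc 3) hε.ne'] at key
  refine (le_of_eq (congrArg _ ?_)).trans key
  have e : ∀ x : Euc 3, coordDistSq Finset.univ 0 x = ‖x‖ ^ 2 := fun x => by
    simp [coordDistSq, EuclideanSpace.norm_sq_eq]
  set G : ℝ → ℝ := fun t => (2 * t ^ 2 + 3 * ε ^ 2) / √(t ^ 2 + ε ^ 2) ^ 3 with hG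
  have e2 : ∫ x : Euc 3 in Metric.closedBall 0 r, (((Finset.univ : Finset (Fin 3)).card - 1) *
      coordDistSq Finset.univ 0 x + (Finset.univ : Finset (Fin 3)).card * ε ^ 2) /
      √(coordDistSq Finset.univ 0 x + ε ^ 2) ^ 3 = ∫ x : Euc 3, (Iic r).indicator G ‖x‖ := by
    rw [← integral_indicator Metric.isClosed_closedBall.measurableSet]
    congr 1
    funext x
    simp only [indicator, mem_closedBall_zero_iff, mem_Iic, e, hG]
    norm_num
  have e3 : ∫ t in Ioi (0 : ℝ), t ^ 2 • (Iic r).indicator G t = ∫ t in (0 : ℝ)..r, t ^ 2 * G t := by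
    rw [intervalIntegral.integral_of_le hr.le, ← Ioi_inter_Iic,
      ← setIntegral_indicator measurableSet_Iic]
    congr 1
    funext t
    simp only [indicator, smul_eq_mul]
    split_ifs <;> simp
  rw [e2, integral_fun_norm_addHaar, finrank_euclideanSpace_fin, e3, ← integral_flux hε.ne',
    Measure.real, EuclideanSpace.volume_ball_fin_three, hG]
  have e4 : (ENNReal.ofReal 1 ^ 3 * ENNReal.ofReal (Real.pi * 4 / 3)).toReal =
      Real.pi * 4 / 3 := by
    simp [ENNReal.toReal_ofReal (show 0 ≤ Real.pi * 4 / 3 by positivity)]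
  rw [e4]
  norm_num
  ring

/-! ### Measurability of the perimeter of neighbourhoods -/

/-- The difference is the frontier of the open thickening, which is again convex, and frontiers of
convex sets are null. -/
theorem volume_cthickening_diff_thickening_of_convex {d : ℕ} {S : Set (Euc d)} (hS : Convex ℝ S)
    {r : ℝ} (hr : 0 < r) : volume (Metric.cthickening r S \ Metric.thickening r S) = 0 := by
  have h := (hS.thickening r).addHaar_frontier (volume : Measure (Euc d))
  rwa [frontier, closure_thickening hr, Metric.isOpen_thickening.interior_eq] at h

/-- By compactness, a point at distance `r` from `K` has a nearest point in some piece `S i`, and it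
is then at distance exactly `r` from that piece. -/
theorem volume_cthickening_diff_thickening {d : ℕ} {K : Set (Euc d)} (hK : IsCompact K)
    {ι : Type*} [Countable ι] {S : ι → Set (Euc d)} (hS : ∀ i, Convex ℝ (S i)) (hKS : K = ⋃ i, S i)
    {r : ℝ} (hr : 0 < r) : volume (Metric.cthickening r K \ Metric.thickening r K) = 0 := by
  refine measure_mono_null (t := ⋃ i, (Metric.cthickening r (S i) \ Metric.thickening r (S i))) ?_
    (measure_iUnion_null fun i => volume_cthickening_diff_thickening_of_convex (hS i) hr)
  rintro x ⟨hx, hx'⟩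
  rw [hK.cthickening_eq_biUnion_closedBall hr.le] at hx
  simp only [mem_iUnion, exists_prop] at hx
  obtain ⟨y, hy, hxy⟩ := hx
  rw [hKS, mem_iUnion] at hy
  obtain ⟨i, hi⟩ := hy
  refine mem_iUnion.2 ⟨i, Metric.mem_cthickening_of_dist_le x y r _ hi hxy, fun h => hx' ?_⟩
  rw [hKS]
  exact Metric.thickening_subset_of_subset r (subset_iUnion S i) h

/-- Dominated convergence: almost every `x` has distance to `K` different from `r`, so its
membership in the neighbourhood is constant for radii near `r`. -/
theorem continuousAt_setIntegral_cthickening {d : ℕ} {K : Set (Euc d)} {f : Euc d → ℝ}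
    (hf : Integrable f) {r : ℝ}
    (hK : volume (Metric.cthickening r K \ Metric.thickening r K) = 0) :
    ContinuousAt (fun s => ∫ x in Metric.cthickening s K, f x) r := by
  have hm : ∀ s, MeasurableSet (Metric.cthickening s K) := fun s =>
    Metric.isClosed_cthickening.measurableSet
  simp only [← integral_indicator (hm _)]
  refine continuousAt_of_dominated (bound := fun x => ‖f x‖)
    (Filter.Eventually.of_forall fun s => hf.aestronglyMeasurable.indicator (hm s))
    (Filter.Eventually.of_forall fun s => Filter.Eventually.of_forall fun x =>
      norm_indicator_le_norm_self _ _) hf.norm ?_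
  filter_upwards [measure_eq_zero_iff_ae_notMem.1 hK] with x hx
  by_cases h : x ∈ Metric.thickening r K
  · have h1 : Metric.infEDist x K < ENNReal.ofReal r := h
    have h2 := (ENNReal.continuous_ofReal.tendsto r).eventually (lt_mem_nhds h1)
    refine continuousAt_const.congr (f := fun _ => f x) ?_
    filter_upwards [h2] with s hs
    exact (indicator_of_mem (Metric.mem_cthickening_iff.2 hs.le) f).symm
  · have h0 : x ∉ Metric.cthickening r K := fun h' => hx ⟨h', h⟩
    have h1 : ENNReal.ofReal r < Metric.infEDist x K := not_le.1 h0
    have h2 := (ENNReal.continuous_ofReal.tendsto r).eventually (gt_mem_nhds h1)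
    refine continuousAt_const.congr (f := fun _ => (0 : ℝ)) ?_
    filter_upwards [h2] with s hs
    exact (indicator_of_notMem (fun h' => not_le.2 hs (Metric.mem_cthickening_iff.1 h')) f).symm

/-- The perimeter of the neighbourhoods is measurable as it is lower semicontinuous. -/
theorem aemeasurable_perimeter_cthickening {d : ℕ} {K : Set (Euc d)}
    (hK : ∀ r : ℝ, 0 < r → volume (Metric.cthickening r K \ Metric.thickening r K) = 0) :
    AEMeasurable (fun r : ℝ => perimeter (Metric.cthickening r K))
      (volume.restrict (Ioi (0 : ℝ))) := by
  refine aemeasurable_restrict_of_measurable_subtype measurableSet_Ioi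
    (LowerSemicontinuous.measurable ?_)
  unfold perimeter
  refine lowerSemicontinuous_iSup fun φ => lowerSemicontinuous_iSup fun hφ => ?_
  refine Continuous.lowerSemicontinuous (ENNReal.continuous_ofReal.comp ?_)
  have hi : Integrable (divergence φ) := (continuous_divergence hφ.1).integrable_of_hasCompactSupport
    (hasCompactSupport_divergence hφ.2.1)
  exact continuous_iff_continuousAt.2 fun r =>
    (continuousAt_setIntegral_cthickening hi (hK r r.2)).comp continuousAt_subtype_val

/-! ### Geometry of the segments and their tubes -/

/-- The vertical unit segment over the point `(p, 0)`. -/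
def unitSegment (p : ℝ) : Set (Euc 3) := {x | x 0 = p ∧ x 1 = 0 ∧ x 2 ∈ Icc (0 : ℝ) 1}

/-- The part of `segmentSet α` which remains when the first `m - 1` segments are removed. -/
def segmentTail (α : ℝ) (m : ℕ) : Set (Euc 3) :=
  {x | ((∃ n : ℕ, m ≤ n ∧ x 0 = (n : ℝ) ^ (-α)) ∨ x 0 = 0) ∧ x 1 = 0 ∧ x 2 ∈ Icc (0 : ℝ) 1}

theorem segmentTail_eq_union (α : ℝ) (m : ℕ) :
    segmentTail α m = unitSegment ((m : ℝ) ^ (-α)) ∪ segmentTail α (m + 1) := by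
  ext x
  simp only [segmentTail, unitSegment, mem_ofPred_eq, mem_union]
  constructor
  · rintro ⟨⟨n, hn, h⟩ | h, h'⟩
    · rcases hn.eq_or_lt with rfl | hn
      · exact Or.inl ⟨h, h'⟩
      · exact Or.inr ⟨Or.inl ⟨n, hn, h⟩, h'⟩
    · exact Or.inr ⟨Or.inr h, h'⟩
  · rintro (⟨h, h'⟩ | ⟨⟨n, hn, h⟩ | h, h'⟩)
    · exact ⟨Or.inl ⟨m, le_rfl, h⟩, h'⟩
    · exact ⟨Or.inl ⟨n, by omega, h⟩, h'⟩
    · exact ⟨Or.inr h, h'⟩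

theorem isCompact_prod_vertical {C : Set ℝ} (hC : IsCompact C) :
    IsCompact {x : Euc 3 | x 0 ∈ C ∧ x 1 = 0 ∧ x 2 ∈ Icc (0 : ℝ) 1} := by
  have hc : Continuous fun q : ℝ × ℝ => (WithLp.toLp 2 ![q.1, 0, q.2] : Euc 3) := by
    refine (PiLp.continuous_toLp 2 _).comp (continuous_pi fun i => ?_)
    fin_cases i <;> simp <;> fun_prop
  convert (hC.prod (isCompact_Icc (a := (0 : ℝ)) (b := 1))).image hc
  ext x
  simp only [mem_ofPred_eq, mem_image, mem_prod, Prod.exists]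
  constructor
  · rintro ⟨h0, h1, h2⟩
    refine ⟨x 0, x 2, ⟨h0, h2⟩, ?_⟩
    ext i
    fin_cases i <;> simp [h1]
  · rintro ⟨a, b, ⟨ha, hb⟩, rfl⟩
    simpa using ⟨ha, hb⟩

theorem isCompact_unitSegment (p : ℝ) : IsCompact (unitSegment p) :=
  isCompact_prod_vertical isCompact_singleton

theorem convex_unitSegment (p : ℝ) : Convex ℝ (unitSegment p) := by
  rintro x ⟨h0, h1, h2⟩ y ⟨k0, k1, k2⟩ a b ha hb hab
  refine ⟨?_, ?_, ?_⟩
  · simp only [PiLp.add_apply, PiLp.smul_apply, smul_eq_mul, h0, k0]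
    rw [← add_mul, hab, one_mul]
  · simp [h1, k1]
  · exact convex_Icc (0 : ℝ) 1 h2 k2 ha hb hab

theorem isCompact_segmentTail {α : ℝ} (hα : 0 < α) (m : ℕ) : IsCompact (segmentTail α m) := by
  have ht : Filter.Tendsto (fun k : ℕ => ((k + m : ℕ) : ℝ) ^ (-α)) Filter.atTop (nhds 0) :=
    (tendsto_rpow_neg_atTop hα).comp (tendsto_natCast_atTop_atTop.comp
      (Filter.tendsto_add_atTop_nat m))
  convert isCompact_prod_vertical ht.isCompact_insert_range using 1
  ext x
  have : (∃ n : ℕ, m ≤ n ∧ x 0 = (n : ℝ) ^ (-α)) ↔ ∃ k : ℕ, ((k + m : ℕ) : ℝ) ^ (-α) = x 0 :=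
    ⟨fun ⟨n, hn, h⟩ => ⟨n - m, by rw [Nat.sub_add_cancel hn, h]⟩,
      fun ⟨k, h⟩ => ⟨k + m, by omega, h.symm⟩⟩
  simp only [segmentTail, mem_ofPred_eq, mem_insert_iff, mem_range, this]
  rw [or_comm (b := x 0 = 0)]

theorem segmentSet_eq_iUnion (α : ℝ) :
    segmentSet α = ⋃ i : Option ℕ, unitSegment (i.elim 0 fun n => ((n + 1 : ℕ) : ℝ) ^ (-α)) := by
  ext x
  simp only [segmentSet, unitSegment, mem_ofPred_eq, mem_iUnion, Option.exists, Option.elim]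
  constructor
  · rintro ⟨⟨n, hn, h⟩ | h, h'⟩
    · exact Or.inr ⟨n - 1, by rw [Nat.sub_add_cancel hn]; exact ⟨h, h'⟩⟩
    · exact Or.inl ⟨h, h'⟩
  · rintro (⟨h, h'⟩ | ⟨n, h, h'⟩)
    · exact ⟨Or.inr h, h'⟩
    · exact ⟨Or.inl ⟨n + 1, by omega, h⟩, h'⟩

theorem volume_cthickening_segmentSet_diff {α : ℝ} (hα : 0 < α) {r : ℝ} (hr : 0 < r) :
    volume (Metric.cthickening r (segmentSet α) \ Metric.thickening r (segmentSet α)) = 0 :=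
  -- `segmentSet α` unfolds to `segmentTail α 1`; this identification is used repeatedly.
  volume_cthickening_diff_thickening (isCompact_segmentTail hα 1) (fun _ => convex_unitSegment _)
    (segmentSet_eq_iUnion α) hr

theorem cylinder_subset_cthickening_unitSegment (p : Euc 3) (hp : p 1 = 0) {r : ℝ} (hr : 0 ≤ r) :
    {x : Euc 3 | coordDistSq {0, 1} p x ≤ r ^ 2 ∧ x 2 ∈ Icc (0 : ℝ) 1} ⊆
      Metric.cthickening r (unitSegment (p 0)) := by
  rintro x ⟨h, hx⟩
  refine Metric.mem_cthickening_of_dist_le x (WithLp.toLp 2 ![p 0, 0, x 2]) r _ ?_ ?_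
  · simpa [unitSegment] using hx
  · rw [EuclideanSpace.dist_eq, Real.sqrt_le_left hr]
    simpa [coordDistSq, Fin.sum_univ_three, Real.dist_eq, sq_abs, hp] using h

theorem perimeter_cthickening_unitSegment_ge (p : ℝ) {r : ℝ} (hr : 0 < r) :
    ENNReal.ofReal (2 * Real.pi * r) ≤ perimeter (Metric.cthickening r (unitSegment p)) :=
  perimeter_ge_of_cylinder_subset (isCompact_unitSegment p).cthickening hr
    (WithLp.toLp 2 ![p, 0, 0])
    (cylinder_subset_cthickening_unitSegment (WithLp.toLp 2 ![p, 0, 0]) (by simp) hr.le)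

theorem abs_sub_coord_zero_le_dist {x y : Euc 3} : |x 0 - y 0| ≤ dist x y := by
  have := PiLp.norm_apply_le (x - y) 0
  rwa [← dist_eq_norm] at this

theorem disjoint_cthickening {A B : Set (Euc 3)} (hA : IsCompact A) (hB : IsCompact B) {a b r : ℝ}
    (hr : 0 ≤ r) (hAa : ∀ x ∈ A, a ≤ x 0) (hBb : ∀ x ∈ B, x 0 ≤ b) (h : 2 * r < a - b) :
    Disjoint (Metric.cthickening r A) (Metric.cthickening r B) := by
  rw [hA.cthickening_eq_biUnion_closedBall hr, hB.cthickening_eq_biUnion_closedBall hr,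
    Set.disjoint_left]
  intro x hx hx'
  simp only [mem_iUnion, exists_prop, Metric.mem_closedBall] at hx hx'
  obtain ⟨y, hy, hxy⟩ := hx
  obtain ⟨z, hz, hxz⟩ := hx'
  have h1 := abs_le.1 ((abs_sub_coord_zero_le_dist (x := x) (y := y)).trans hxy)
  have h2 := abs_le.1 ((abs_sub_coord_zero_le_dist (x := x) (y := z)).trans hxz)
  linarith [hAa y hy, hBb z hz, h1.1, h2.2]

/-- The first segment is peeled off: everything left has first coordinate at most `(m+1)^(-α)`, so
the gap condition separates the neighbourhoods and superadditivity applies. The start `m` varies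
along the induction. -/
theorem perimeter_cthickening_segmentTail_ge {α : ℝ} (hα : 0 < α) {r : ℝ} (hr : 0 < r) (n : ℕ) :
    ∀ m : ℕ, 1 ≤ m → (∀ i < n, 2 * r < ((m + i : ℕ) : ℝ) ^ (-α) - ((m + i + 1 : ℕ) : ℝ) ^ (-α)) →
      n * ENNReal.ofReal (2 * Real.pi * r) ≤
        perimeter (Metric.cthickening r (segmentTail α m)) := by
  induction n with
  | zero => simp
  | succ n ih =>
    intro m hm h
    have h1 := ih (m + 1) (by omega) fun i hi => by
      have := h (i + 1) (by omega)
      rwa [show m + (i + 1) = m + 1 + i by ring] at this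
    have h2 := perimeter_cthickening_unitSegment_ge ((m : ℝ) ^ (-α)) hr
    rw [segmentTail_eq_union, Metric.cthickening_union]
    refine le_trans ?_ (perimeter_add_le_union (isCompact_unitSegment _).cthickening
      (isCompact_segmentTail hα _).cthickening (disjoint_cthickening (isCompact_unitSegment _)
      (isCompact_segmentTail hα _) hr.le (fun x hx => hx.1.ge) (b := ((m + 1 : ℕ) : ℝ) ^ (-α))
      ?_ (h 0 (by omega))))
    · rw [Nat.cast_succ, add_mul, one_mul, add_comm]
      exact add_le_add h2 h1
    · rintro x ⟨⟨k, hk, hx⟩ | hx, -⟩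
      · rw [hx]
        exact Real.rpow_le_rpow_of_nonpos (by positivity) (by exact_mod_cast hk) (by linarith)
      · rw [hx]
        positivity

/-! ### Counting disjoint tubes and integrating the bounds -/

/-- After division by `(x+1)^(-α)` this is a Bernoulli inequality, obtained from `1 + y ≤ exp y` and
`log y ≤ y - 1`. -/
theorem mul_rpow_le_rpow_sub {α : ℝ} (hα : 0 < α) {x : ℝ} (hx : 0 < x) :
    α * (x + 1) ^ (-(α + 1)) ≤ x ^ (-α) - (x + 1) ^ (-α) := by
  have hx1 : 0 < x + 1 := by linarith
  have h0 : 0 < x / (x + 1) := by positivity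
  have h1 : 1 + α * (1 / (x + 1)) ≤ (x / (x + 1)) ^ (-α) := by
    rw [Real.rpow_def_of_pos h0]
    have h2 := Real.add_one_le_exp (Real.log (x / (x + 1)) * -α)
    have h3 := Real.log_le_sub_one_of_pos h0
    have h4 : x / (x + 1) - 1 = -(1 / (x + 1)) := by field_simp; ring
    rw [h4] at h3
    nlinarith
  rw [Real.div_rpow hx.le hx1.le, le_div_iff₀ (by positivity)] at h1
  have h5 : (x + 1) ^ (-(α + 1)) = (x + 1) ^ (-α) * (1 / (x + 1)) := by
    rw [neg_add, Real.rpow_add hx1, Real.rpow_neg_one, one_div]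
  rw [h5]
  linarith

theorem two_mul_lt_rpow_sub {α : ℝ} (hα : 0 < α) {r : ℝ} (hr : 0 < r) {n i : ℕ} (hi : i < n)
    (hn : (n + 1 : ℝ) < (α / (2 * r)) ^ (1 / (α + 1))) :
    2 * r < ((1 + i : ℕ) : ℝ) ^ (-α) - ((1 + i + 1 : ℕ) : ℝ) ^ (-α) := by
  have h1 := mul_rpow_le_rpow_sub hα (x := ((1 + i : ℕ) : ℝ)) (by positivity)
  rw [← Nat.cast_succ] at h1
  refine lt_of_lt_of_le ?_ h1
  have h2 : ((1 + i + 1 : ℕ) : ℝ) < (α / (2 * r)) ^ (1 / (α + 1)) := lt_of_le_of_lt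
    (by exact_mod_cast (by omega : 1 + i + 1 ≤ n + 1)) hn
  have h3 : ((1 + i + 1 : ℕ) : ℝ) ^ (α + 1) < α / (2 * r) := by
    have := Real.rpow_lt_rpow (by positivity) h2 (by linarith : 0 < α + 1)
    rwa [← Real.rpow_mul (by positivity), one_div_mul_cancel (by positivity), Real.rpow_one] at this
  rw [Real.rpow_neg (by positivity), ← div_eq_mul_inv, lt_div_iff₀ (by positivity)]
  rw [lt_div_iff₀ (by positivity)] at h3
  linarith

theorem perimeter_cthickening_segmentSet_ge_sphere {α : ℝ} (hα : 0 < α) {r : ℝ} (hr : 0 < r) :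
    ENNReal.ofReal (4 * Real.pi * r ^ 2) ≤ perimeter (Metric.cthickening r (segmentSet α)) :=
  perimeter_ge_of_closedBall_subset (isCompact_segmentTail hα 1).cthickening hr
    (Metric.closedBall_subset_cthickening
      (show (0 : Euc 3) ∈ segmentSet α from ⟨Or.inr rfl, rfl, by simp⟩) r)

theorem perimeter_cthickening_segmentSet_ge_tubes {α : ℝ} (hα : 0 < α) {r : ℝ} (hr : 0 < r)
    (h : 2 < (α / (2 * r)) ^ (1 / (α + 1))) :
    ENNReal.ofReal (2 * Real.pi / 3 * r * (α / (2 * r)) ^ (1 / (α + 1))) ≤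
      perimeter (Metric.cthickening r (segmentSet α)) := by
  set T := (α / (2 * r)) ^ (1 / (α + 1)) with hT
  -- With `n + 2 < T ≤ n + 3`, the first `n + 1` gaps exceed `2r`; and `n + 3 ≤ 3(n + 1)` gives at
  -- least `T/3` tubes, whence the factor `3`.
  obtain ⟨n, hn⟩ : ∃ n, ⌈T⌉₊ = n + 3 :=
    Nat.exists_eq_add_of_le' (Nat.lt_ceil.2 (by exact_mod_cast h))
  have h1 : T ≤ n + 3 := by
    have := Nat.le_ceil T
    rw [hn] at this
    exact_mod_cast this
  have h2 : ((n + 1 : ℕ) + 1 : ℝ) < T := by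
    have : n + 2 < ⌈T⌉₊ := by omega
    have := Nat.lt_ceil.1 this
    push_cast at this ⊢
    linarith
  have h3 := perimeter_cthickening_segmentTail_ge hα hr (n + 1) 1 le_rfl fun i hi =>
    two_mul_lt_rpow_sub hα hr hi h2
  refine le_trans ?_ h3
  rw [← ENNReal.ofReal_natCast, ← ENNReal.ofReal_mul (by positivity)]
  refine ENNReal.ofReal_le_ofReal ?_
  push_cast
  have h4 : T ≤ 3 * (n + 1) := by linarith [(Nat.cast_nonneg n : (0 : ℝ) ≤ n)]
  have := mul_le_mul_of_nonneg_left h4 (by positivity : 0 ≤ 2 * Real.pi / 3 * r)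
  linarith

theorem invPerimeterIntegral_segmentSet_le {α : ℝ} (hα : 0 < α) :
    invPerimeterIntegral (segmentSet α) ≤
      ENNReal.ofReal (((2 : ℝ) ^ (α + 2) + 3 * α * (α + 1)) / (4 * Real.pi * α)) := by
  -- The radius at which `T = 2`: the tube bound is used below it and the sphere bound above.
  set R : ℝ := α / 2 * 2 ^ (-(α + 1)) with hR
  have hR0 : 0 < R := by positivity
  have hb : 0 < 1 / (α + 1) := by positivity
  set β := 1 / (α + 1) with hβ
  have hlt : ∀ r ∈ Ioo 0 R, 2 < (α / (2 * r)) ^ β := by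
    rintro r ⟨hr, hrR⟩
    have h1 : (2 : ℝ) ^ (α + 1) < α / (2 * r) := by
      rw [hR, Real.rpow_neg zero_le_two, ← div_eq_mul_inv, lt_div_iff₀ (by positivity)] at hrR
      rw [lt_div_iff₀ (by positivity)]
      linarith
    have := Real.rpow_lt_rpow (by positivity) h1 hb
    rwa [← Real.rpow_mul zero_le_two, hβ, mul_one_div_cancel (by positivity), Real.rpow_one] at this
  have i1 : ∫⁻ r in Ioo 0 R, (perimeter (Metric.cthickening r (segmentSet α)))⁻¹ ≤
      ENNReal.ofReal (3 * (α + 1) / (4 * Real.pi)) := by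
    have hle : ∀ r ∈ Ioo 0 R, (perimeter (Metric.cthickening r (segmentSet α)))⁻¹ ≤
        ENNReal.ofReal (3 / (2 * Real.pi) * (2 / α) ^ β * r ^ (β - 1)) := fun r hr => by
      have hr0 : 0 < r := hr.1
      refine (ENNReal.inv_le_inv.2 (perimeter_cthickening_segmentSet_ge_tubes hα hr0
        (hlt r hr))).trans (le_of_eq ?_)
      rw [← ENNReal.ofReal_inv_of_pos (by positivity)]
      congr 1
      rw [Real.rpow_sub_one hr0.ne', Real.div_rpow hα.le (by positivity),
        Real.mul_rpow zero_le_two hr0.le, Real.div_rpow zero_le_two hα.le]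
      field_simp
      simp only [hβ]
      ring
    refine (setLIntegral_mono' measurableSet_Ioo hle).trans
      ((lintegral_mono_set Ioo_subset_Ioc_self).trans (le_of_eq ?_))
    have hint : IntegrableOn (fun r : ℝ => 3 / (2 * Real.pi) * (2 / α) ^ β * r ^ (β - 1))
        (Ioc 0 R) := ((intervalIntegral.intervalIntegrable_rpow' (by linarith)).1).const_mul _
    rw [← ofReal_integral_eq_lintegral_ofReal hint
      ((ae_restrict_iff' measurableSet_Ioc).2 (Filter.Eventually.of_forall fun r hr =>
        have := hr.1
        by positivity)), ← intervalIntegral.integral_of_le hR0.le,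
      intervalIntegral.integral_const_mul, integral_rpow (Or.inl (by linarith))]
    congr 1
    have e1 : R ^ β = (2 / α) ^ (-β) * 2⁻¹ := by
      rw [hR, Real.mul_rpow (by positivity) (by positivity), ← Real.rpow_mul zero_le_two,
        Real.rpow_neg (by positivity), ← Real.inv_rpow (by positivity), inv_div, hβ,
        neg_mul, mul_one_div_cancel (by positivity), Real.rpow_neg_one]
    rw [sub_add_cancel, Real.zero_rpow hb.ne', sub_zero, e1, Real.rpow_neg (by positivity), hβ]
    field_simp
    norm_num
  have i2 : ∫⁻ r in Ici R, (perimeter (Metric.cthickening r (segmentSet α)))⁻¹ ≤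
      ENNReal.ofReal ((2 : ℝ) ^ (α + 2) / (4 * Real.pi * α)) := by
    have hle : ∀ r ∈ Ici R, (perimeter (Metric.cthickening r (segmentSet α)))⁻¹ ≤
        ENNReal.ofReal ((4 * Real.pi)⁻¹ * r ^ (-2 : ℝ)) := fun r hr => by
      have hr0 : 0 < r := hR0.trans_le hr
      refine (ENNReal.inv_le_inv.2 (perimeter_cthickening_segmentSet_ge_sphere hα hr0)).trans
        (le_of_eq ?_)
      rw [← ENNReal.ofReal_inv_of_pos (by positivity), Real.rpow_neg hr0.le, mul_inv]
      norm_cast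
    refine (setLIntegral_mono' measurableSet_Ici hle).trans (le_of_eq ?_)
    rw [← restrict_Ioi_eq_restrict_Ici]
    have hint : IntegrableOn (fun r : ℝ => (4 * Real.pi)⁻¹ * r ^ (-2 : ℝ)) (Ioi R) :=
      (integrableOn_Ioi_rpow_of_lt (by norm_num) hR0).const_mul _
    rw [← ofReal_integral_eq_lintegral_ofReal hint
      ((ae_restrict_iff' measurableSet_Ioi).2 (Filter.Eventually.of_forall fun r hr =>
        have : 0 < r := hR0.trans hr
        by positivity)), integral_const_mul, integral_Ioi_rpow_of_lt (by norm_num) hR0]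
    congr 1
    rw [show (-2 + 1 : ℝ) = -1 by norm_num, Real.rpow_neg_one, hR, Real.rpow_neg zero_le_two,
      show α + 2 = (α + 1) + 1 by ring, Real.rpow_add_one two_ne_zero (α + 1)]
    field_simp
  have hsub : Ioi (0 : ℝ) ⊆ Ioo 0 R ∪ Ici R := fun r hr => by
    rcases lt_or_ge r R with h | h
    · exact Or.inl ⟨hr, h⟩
    · exact Or.inr h
  refine (lintegral_mono_set hsub).trans ((lintegral_union_le _ _ _).trans
    ((add_le_add i1 i2).trans (le_of_eq ?_)))
  rw [← ENNReal.ofReal_add (by positivity) (by positivity)]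
  congr 1
  field_simp
  ring

/-! ### The complement has no bounded component -/

/-- The set lies in the plane where coordinate `1` vanishes. From any point off the set, a ray
orthogonal to this plane, pointing away from it, avoids the set and is unbounded. -/
theorem filledHull_segmentSet (α : ℝ) : filledHull (segmentSet α) = segmentSet α := by
  refine union_eq_self_of_subset_right ?_
  rintro x ⟨hx, hb⟩
  exfalso
  obtain ⟨c, hc, hcx⟩ : ∃ c : ℝ, |c| = 1 ∧ 0 ≤ c * x 1 := by
    rcases le_total 0 (x 1) with h | h
    · exact ⟨1, by simp, by simpa⟩
    · exact ⟨-1, by simp, by linarith⟩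
  set γ : ℝ → Euc 3 := fun t => x + (t * c) • EuclideanSpace.single 1 (1 : ℝ) with hγ
  have hγc : Continuous γ := by fun_prop
  have hpre : IsPreconnected (γ '' Ici 0) := isPreconnected_Ici.image γ hγc.continuousOn
  have hsub : γ '' Ici 0 ⊆ (segmentSet α)ᶜ := by
    rintro _ ⟨t, ht, rfl⟩ hmem
    have h1 : γ t 1 = x 1 + t * c := by simp [hγ]
    have h2 : x 1 + t * c = 0 := h1 ▸ hmem.2.1
    have hcc : c * c = 1 := by rw [← abs_mul_abs_self, hc, one_mul]
    have h3 : t = 0 := by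
      have : c * x 1 + t * (c * c) = 0 := by linear_combination c * h2
      rw [hcc, mul_one] at this
      exact le_antisymm (by linarith) ht
    apply hx
    simpa [hγ, h3] using hmem
  have hcomp := hpre.subset_connectedComponentIn (x := x) ⟨0, self_mem_Ici, by simp [hγ]⟩ hsub
  obtain ⟨C, hC⟩ := (Metric.isBounded_iff.1 (hb.subset hcomp))
  have h1 := hC (mem_image_of_mem γ (self_mem_Ici (a := (0 : ℝ))))
    (mem_image_of_mem γ (mem_Ici.2 (by positivity : (0 : ℝ) ≤ |C| + 1)))
  have h2 : dist (γ 0) (γ (|C| + 1)) = |C| + 1 := by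
    simp [hγ, norm_smul, hc, abs_of_nonneg (by positivity : (0 : ℝ) ≤ |C| + 1)]
  linarith [le_abs_self C]

/-! ### Vanishing capacity -/

/-- `S` is dominated by a `C¹` compactly supported function of Dirichlet integral at most `ε`. -/
def HasEnergyLE {d : ℕ} (S : Set (Euc d)) (ε : ℝ) : Prop :=
  ∃ u : Euc d → ℝ, ContDiff ℝ 1 u ∧ HasCompactSupport u ∧ (∀ x, 0 ≤ u x) ∧
    (∀ x ∈ S, 1 < u x) ∧ ∫ x, ‖fderiv ℝ u x‖ ^ 2 ≤ ε

theorem isD1WithGradient_gradient {d : ℕ} {u : Euc d → ℝ} (hu : ContDiff ℝ 1 u)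
    (hc : HasCompactSupport u) : IsD1WithGradient u (gradient u) := by
  have hcont : Continuous (gradient u) :=
    (InnerProductSpace.toDual ℝ (Euc d)).symm.continuous.comp (hu.continuous_fderiv one_ne_zero)
  have hcs : HasCompactSupport (gradient u) := (hc.fderiv (𝕜 := ℝ)).comp_left (map_zero _)
  refine ⟨hu.continuous.locallyIntegrable, fun φ hφ hφc v => ?_, hcont.memLp_of_hasCompactSupport hcs,
    fun ε hε => ?_⟩
  · have hφ1 : ContDiff ℝ 1 φ := hφ.of_le (by exact_mod_cast le_top)
    have hf : Continuous fun x => fderiv ℝ u x v :=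
      (hu.continuous_fderiv one_ne_zero).clm_apply continuous_const
    have hg : Continuous fun x => fderiv ℝ φ x v :=
      (hφ1.continuous_fderiv one_ne_zero).clm_apply continuous_const
    rw [integral_mul_fderiv_eq_neg_fderiv_mul_of_integrable
      ((hf.mul hφ1.continuous).integrable_of_hasCompactSupport hφc.mul_left)
      ((hu.continuous.mul hg).integrable_of_hasCompactSupport hc.mul_right)
      ((hu.continuous.mul hφ1.continuous).integrable_of_hasCompactSupport hc.mul_right)
      (fun x _ => hu.differentiable one_ne_zero x) (fun x _ => hφ1.differentiable one_ne_zero x)]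
    simp [gradient]
  · refine lt_of_le_of_lt (measure_mono fun x hx => subset_tsupport u ?_) hc.isCompact.measure_lt_top
    intro h0
    rw [mem_ofPred_eq, h0, abs_zero] at hx
    exact lt_asymm hε hx

theorem hasCompactSupport_norm_fderiv_sq {d : ℕ} {u : Euc d → ℝ} (hc : HasCompactSupport u) :
    HasCompactSupport fun x => ‖fderiv ℝ u x‖ ^ 2 :=
  (hc.fderiv (𝕜 := ℝ)).norm.comp_left (g := fun t : ℝ => t ^ 2) (by simp)

theorem integrable_norm_fderiv_sq {d : ℕ} {u : Euc d → ℝ} (hu : ContDiff ℝ 1 u)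
    (hc : HasCompactSupport u) : Integrable fun x => ‖fderiv ℝ u x‖ ^ 2 :=
  ((hu.continuous_fderiv one_ne_zero).norm.pow 2).integrable_of_hasCompactSupport
    (hasCompactSupport_norm_fderiv_sq hc)

theorem newtonianCapacity_eq_zero_of_hasEnergyLE {d : ℕ} {S : Set (Euc d)}
    (h : ∀ ε : ℝ, 0 < ε → HasEnergyLE S ε) : newtonianCapacity S = 0 := by
  refine le_antisymm (ENNReal.le_of_forall_pos_le_add fun ε hε _ => ?_) zero_le
  obtain ⟨u, hu, hc, h0, h1, hi⟩ := h ε hε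
  rw [zero_add]
  refine le_trans (sInf_le ⟨u, gradient u, isD1WithGradient_gradient hu hc, hu.continuous,
    fun x => indicator_le' (fun x hx => (h1 x hx).le) (fun x _ => h0 x) x, rfl⟩) ?_
  have : ∀ x, ‖gradient u x‖ₑ ^ 2 = ENNReal.ofReal (‖fderiv ℝ u x‖ ^ 2) := fun x => by
    rw [ENNReal.ofReal_pow (norm_nonneg _), ofReal_norm, gradient, LinearIsometryEquiv.enorm_map]
  simp only [this]
  rw [← ofReal_integral_eq_lintegral_ofReal (integrable_norm_fderiv_sq hu hc)
    (Filter.Eventually.of_forall fun x => by positivity), ← ENNReal.ofReal_coe_nnreal]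
  exact ENNReal.ofReal_le_ofReal hi

/-- The sum of the two functions works, by `(a + b)² ≤ 2a² + 2b²`. The loss of a factor is harmless
for sets of arbitrarily small energy. -/
theorem HasEnergyLE.union {d : ℕ} {S T : Set (Euc d)} {ε : ℝ} (hS : HasEnergyLE S ε)
    (hT : HasEnergyLE T ε) : HasEnergyLE (S ∪ T) (4 * ε) := by
  obtain ⟨u, hu, hc, h0, h1, hi⟩ := hS
  obtain ⟨v, kv, kc, k0, k1, ki⟩ := hT
  refine ⟨fun x => u x + v x, hu.add kv, hc.add kc, fun x => add_nonneg (h0 x) (k0 x), ?_, ?_⟩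
  · rintro x (hx | hx)
    · linarith [h1 x hx, k0 x]
    · linarith [k1 x hx, h0 x]
  · have iu := integrable_norm_fderiv_sq hu hc
    have iv := integrable_norm_fderiv_sq kv kc
    have : ∫ x, ‖fderiv ℝ (fun x => u x + v x) x‖ ^ 2 ≤
        ∫ x, (2 * ‖fderiv ℝ u x‖ ^ 2 + 2 * ‖fderiv ℝ v x‖ ^ 2) := by
      refine integral_mono (integrable_norm_fderiv_sq (hu.add kv) (hc.add kc))
        ((iu.const_mul 2).add (iv.const_mul 2)) fun x => ?_
      simp only
      rw [fderiv_fun_add (hu.differentiable one_ne_zero x) (kv.differentiable one_ne_zero x)]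
      have := pow_le_pow_left₀ (norm_nonneg _) (norm_add_le (fderiv ℝ u x) (fderiv ℝ v x)) 2
      nlinarith [sq_nonneg (‖fderiv ℝ u x‖ - ‖fderiv ℝ v x‖)]
    rw [integral_add (iu.const_mul 2) (iv.const_mul 2), integral_const_mul,
      integral_const_mul] at this
    linarith

theorem hasFDerivAt_coordDistSq {d : ℕ} (J : Finset (Fin d)) (p x : Euc d) :
    ∃ L : Euc d →L[ℝ] ℝ, HasFDerivAt (coordDistSq J p) L x ∧
      ‖L‖ ^ 2 ≤ 4 * coordDistSq J p x := by
  refine ⟨∑ j ∈ J, (2 * (x j - p j)) • (EuclideanSpace.proj j : Euc d →L[ℝ] ℝ), ?_, ?_⟩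
  · unfold coordDistSq
    refine HasFDerivAt.fun_sum fun j _ => ?_
    have := ((EuclideanSpace.proj j : Euc d →L[ℝ] ℝ).hasFDerivAt (x := x)).sub_const (p j)
    simpa using this.pow 2
  · have h0 := coordDistSq_nonneg J p x
    have : ‖∑ j ∈ J, (2 * (x j - p j)) • (EuclideanSpace.proj j : Euc d →L[ℝ] ℝ)‖ ≤
        2 * √(coordDistSq J p x) := by
      refine ContinuousLinearMap.opNorm_le_bound _ (by positivity) fun v => ?_
      have hv : √(∑ j ∈ J, v j ^ 2) ≤ ‖v‖ := by
        rw [EuclideanSpace.norm_eq]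
        refine Real.sqrt_le_sqrt ?_
        simp only [Real.norm_eq_abs, sq_abs]
        exact Finset.sum_le_sum_of_subset_of_nonneg (Finset.subset_univ J)
          fun _ _ _ => sq_nonneg _
      have e : (∑ j ∈ J, (2 * (x j - p j)) • (EuclideanSpace.proj j : Euc d →L[ℝ] ℝ)) v =
          2 * ∑ j ∈ J, (x j - p j) * v j := by
        simp [Finset.mul_sum, mul_assoc]
      rw [e, norm_mul, Real.norm_of_nonneg zero_le_two, mul_assoc, Real.norm_eq_abs]
      refine mul_le_mul_of_nonneg_left ?_ zero_le_two
      have cs : |∑ j ∈ J, (x j - p j) * v j| ≤ √(coordDistSq J p x) * √(∑ j ∈ J, v j ^ 2) := by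
        rw [← Real.sqrt_mul h0, ← Real.sqrt_sq_eq_abs]
        exact Real.sqrt_le_sqrt (Finset.sum_mul_sq_le_sq_mul_sq J _ _)
      exact cs.trans (mul_le_mul_of_nonneg_left hv (Real.sqrt_nonneg _))
    calc _ ≤ (2 * √(coordDistSq J p x)) ^ 2 := pow_le_pow_left₀ (norm_nonneg _) this 2
      _ = 4 * coordDistSq J p x := by rw [mul_pow, Real.sq_sqrt h0]; norm_num

/-- A power of the fundamental solution, regularized at scale `δ` and normalized at the origin, as
a function of the squared distance. -/
noncomputable def powerProfile (a δ s : ℝ) : ℝ := (δ ^ 2 / (s + δ ^ 2)) ^ a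

theorem powerProfile_mem_Icc {a δ s : ℝ} (ha : 0 < a) (hδ : 0 < δ) (hs : 0 ≤ s) :
    powerProfile a δ s ∈ Icc (0 : ℝ) 1 :=
  ⟨by unfold powerProfile; positivity, Real.rpow_le_one (by positivity)
    (div_le_one_of_le₀ (le_add_of_nonneg_left hs) (by positivity)) ha.le⟩

theorem hasDerivAt_powerProfile (a : ℝ) {δ s : ℝ} (hδ : 0 < δ) (hs : 0 ≤ s) :
    HasDerivAt (powerProfile a δ) (-(a * powerProfile a δ s / (s + δ ^ 2))) s := by
  have hp : 0 < s + δ ^ 2 := by positivity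
  have h1 : HasDerivAt (fun s => δ ^ 2 / (s + δ ^ 2)) (-(δ ^ 2) / (s + δ ^ 2) ^ 2) s := by
    refine ((hasDerivAt_const s (δ ^ 2)).div ((hasDerivAt_id' s).add_const (δ ^ 2))
      hp.ne').congr_deriv ?_
    simp
  have h2 := h1.rpow_const (p := a) (Or.inl (by positivity))
  refine h2.congr_deriv ?_
  rw [Real.rpow_sub_one (by positivity), powerProfile]
  field_simp

/-- The integrand is the exact derivative of `-a` times the squared profile, so the bound is uniform
in both `δ` and `R`. -/
theorem integral_powerProfile_le {a δ R : ℝ} (ha : 0 < a) (hδ : 0 < δ) :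
    ∫ t in (0 : ℝ)..R, t * (4 * a ^ 2 * powerProfile a δ (t ^ 2) ^ 2 / (t ^ 2 + δ ^ 2)) ≤ a := by
  have hcont : Continuous fun t : ℝ => powerProfile a δ (t ^ 2) :=
    continuous_iff_continuousAt.2 fun t =>
      ContinuousAt.comp (f := fun t : ℝ => t ^ 2)
        (hasDerivAt_powerProfile a hδ (sq_nonneg t)).continuousAt (by fun_prop)
  rw [intervalIntegral.integral_eq_sub_of_hasDerivAt
    (f := fun t => -(a * powerProfile a δ (t ^ 2) ^ 2)) (fun t _ => ?_)]
  · have : powerProfile a δ (0 ^ 2) = 1 := by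
      simp [powerProfile, div_self (pow_pos hδ 2).ne']
    rw [this]
    have : 0 ≤ a * powerProfile a δ (R ^ 2) ^ 2 := by positivity
    linarith
  · exact Continuous.intervalIntegrable (continuous_id.mul (Continuous.div (by fun_prop)
      (by fun_prop) fun t => by positivity)) _ _
  · have hd : HasDerivAt (fun t => powerProfile a δ (t ^ 2)) _ t :=
      HasDerivAt.comp (h := fun t : ℝ => t ^ 2) t
        (hasDerivAt_powerProfile a hδ (sq_nonneg t)) (hasDerivAt_pow 2 t)
    refine (((hd.pow 2).const_mul a).neg).congr_deriv ?_
    simp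
    field_simp
    ring

theorem contDiff_powerProfile_coordDistSq {d : ℕ} (J : Finset (Fin d)) (p : Euc d) (a : ℝ) {δ : ℝ}
    (hδ : 0 < δ) : ContDiff ℝ 1 fun x => powerProfile a δ (coordDistSq J p x) := by
  have hq : ∀ x, 0 < coordDistSq J p x + δ ^ 2 := fun x =>
    add_pos_of_nonneg_of_pos (coordDistSq_nonneg J p x) (by positivity)
  have hqc : ContDiff ℝ 1 (coordDistSq J p) := by
    unfold coordDistSq
    fun_prop
  exact (contDiff_const.div (hqc.add contDiff_const) fun x => (hq x).ne').rpow_const_of_ne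
    fun x => (div_pos (by positivity) (hq x)).ne'

theorem norm_fderiv_powerProfile_sq_le {d : ℕ} (J : Finset (Fin d)) (p : Euc d) (a : ℝ) {δ : ℝ}
    (hδ : 0 < δ) (x : Euc d) :
    ‖fderiv ℝ (fun x => powerProfile a δ (coordDistSq J p x)) x‖ ^ 2 ≤
      4 * a ^ 2 * powerProfile a δ (coordDistSq J p x) ^ 2 / (coordDistSq J p x + δ ^ 2) := by
  obtain ⟨L, hL, hLn⟩ := hasFDerivAt_coordDistSq J p x
  have h0 := coordDistSq_nonneg J p x
  have h1 : HasFDerivAt (fun x => powerProfile a δ (coordDistSq J p x)) _ x :=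
    (hasDerivAt_powerProfile a hδ h0).comp_hasFDerivAt x hL
  rw [h1.fderiv, norm_smul, mul_pow, Real.norm_eq_abs, sq_abs]
  set q := coordDistSq J p x
  calc _ ≤ (-(a * powerProfile a δ q / (q + δ ^ 2))) ^ 2 * (4 * (q + δ ^ 2)) :=
        mul_le_mul_of_nonneg_left (hLn.trans (by nlinarith [sq_nonneg δ])) (sq_nonneg _)
    _ = _ := by field_simp

theorem volume_coordDistSq_eq_zero (p : Euc 3) :
    volume {x : Euc 3 | coordDistSq {0, 1} p x = 0} = 0 := by
  have h := Measure.pi_hyperplane (fun _ : Fin 3 => (volume : Measure ℝ)) 0 (p 0)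
  rw [← volume_pi, ← (EuclideanSpace.volume_preserving_symm_measurableEquiv_toLp
    (Fin 3)).measure_preimage_equiv] at h
  refine measure_mono_null (fun x hx => ?_) h
  have : coordDistSq {0, 1} p x = (x 0 - p 0) ^ 2 + (x 1 - p 1) ^ 2 := by simp [coordDistSq]
  rw [mem_ofPred_eq, this] at hx
  have h2 : (x 0 - p 0) ^ 2 = 0 := by nlinarith [sq_nonneg (x 0 - p 0), sq_nonneg (x 1 - p 1)]
  exact sub_eq_zero.1 (pow_eq_zero_iff two_ne_zero |>.1 h2)

-- As `δ → 0` the profile tends to zero off the axis, which is a null set, while `|f|` dominates.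
open Filter Topology in
theorem tendsto_integral_powerProfile_mul (p : Euc 3) {a : ℝ} (ha : 0 < a) {f : Euc 3 → ℝ}
    (hf : Integrable f) :
    Tendsto (fun n : ℕ => ∫ x, powerProfile a (1 / (n + 1)) (coordDistSq {0, 1} p x) ^ 2 * f x)
      atTop (𝓝 0) := by
  have hz : (0 : ℝ) = ∫ _ : Euc 3, (0 : ℝ) := by simp
  rw [hz]
  refine tendsto_integral_of_dominated_convergence (fun x => ‖f x‖) (fun n => ?_) hf.norm
    (fun n => ?_) ?_
  · exact ((contDiff_powerProfile_coordDistSq {0, 1} p a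
      (by positivity : (0 : ℝ) < 1 / (n + 1))).continuous.pow 2).aestronglyMeasurable.mul
      hf.aestronglyMeasurable
  · refine Eventually.of_forall fun x => ?_
    have := powerProfile_mem_Icc ha (by positivity : (0 : ℝ) < 1 / (n + 1))
      (coordDistSq_nonneg {0, 1} p x)
    rw [norm_mul, norm_pow, Real.norm_of_nonneg this.1]
    exact mul_le_of_le_one_left (norm_nonneg _) (pow_le_one₀ this.1 this.2)
  · filter_upwards [measure_eq_zero_iff_ae_notMem.1 (volume_coordDistSq_eq_zero p)] with x hx
    have hδ : Tendsto (fun n : ℕ => (1 / ((n : ℝ) + 1)) ^ 2) atTop (𝓝 0) := by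
      simpa using (tendsto_one_div_add_atTop_nhds_zero_nat (𝕜 := ℝ)).pow 2
    have h1 : Tendsto (fun n : ℕ => (1 / ((n : ℝ) + 1)) ^ 2 /
        (coordDistSq {0, 1} p x + (1 / ((n : ℝ) + 1)) ^ 2)) atTop (𝓝 0) := by
      have := hδ.div (hδ.const_add (coordDistSq {0, 1} p x)) (by simpa using hx)
      simp only [add_zero, zero_div] at this
      exact this
    have h2 := h1.rpow_const (p := a) (Or.inr ha.le)
    rw [Real.zero_rpow ha.ne'] at h2
    simpa [powerProfile] using (h2.pow 2).mul_const (f x)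

/-- The competitor is `2χh` with a cutoff `χ` and a power profile `h` around the axis. The energy of
`h` on the support of `χ` is of order `a` whatever `δ` is, so `a` is fixed first; then a small `δ`
removes the term containing the gradient of `χ`. -/
theorem hasEnergyLE_unitSegment (p : ℝ) {ε : ℝ} (hε : 0 < ε) :
    HasEnergyLE (unitSegment p) ε := by
  obtain ⟨χ, h1, h2, -, h3, h4⟩ := exists_smooth_cutoff (isCompact_unitSegment p) isOpen_univ
    (subset_univ _)
  have hχ : ContDiff ℝ 1 χ := h1.of_le (by exact_mod_cast le_top)
  set P : Euc 3 := WithLp.toLp 2 ![p, 0, 0] with hP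
  obtain ⟨R, hR0, hR⟩ : ∃ R : ℝ, 0 < R ∧ tsupport χ ⊆ Metric.closedBall P R :=
    (h2.isCompact.isBounded.subset_closedBall_lt 0 P)
  set C : Set (Euc 3) := {x | coordDistSq {0, 1} P x ≤ (2 * R) ^ 2 ∧ x 2 ∈ Icc (-R) R} with hC
  have hsupp : ∀ x ∉ C, χ x = 0 := by
    intro x hx
    by_contra h0
    apply hx
    have hxR : ‖x - P‖ ≤ R := by
      have := hR (subset_tsupport χ h0)
      rwa [Metric.mem_closedBall, dist_eq_norm] at this
    have hi : ∀ i, |x i - P i| ≤ R := fun i => (PiLp.norm_apply_le (x - P) i).trans hxR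
    have hq : coordDistSq {0, 1} P x = (x 0 - P 0) ^ 2 + (x 1 - P 1) ^ 2 := by simp [coordDistSq]
    have i2 := hi 2
    have e2 : P 2 = 0 := by simp [hP]
    rw [e2, sub_zero] at i2
    refine ⟨?_, abs_le.1 i2⟩
    rw [hq]
    nlinarith [sq_le_sq' (abs_le.1 (hi 0)).1 (abs_le.1 (hi 0)).2,
      sq_le_sq' (abs_le.1 (hi 1)).1 (abs_le.1 (hi 1)).2, sq_nonneg R]
  -- The cylinder `C` has height `2R`, so the profile contributes at most `4πRa = ε/16`.
  set a : ℝ := ε / (64 * Real.pi * R) with ha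
  have ha0 : 0 < a := by positivity
  have hint := integrable_norm_fderiv_sq hχ h2
  obtain ⟨n, hn⟩ := ((tendsto_integral_powerProfile_mul P ha0 hint).eventually
    (gt_mem_nhds (by positivity : (0 : ℝ) < ε / 16))).exists
  set δ : ℝ := 1 / (n + 1) with hδ
  have hδ0 : 0 < δ := by positivity
  set h : Euc 3 → ℝ := fun x => powerProfile a δ (coordDistSq {0, 1} P x) with hh
  have hh1 : ContDiff ℝ 1 h := contDiff_powerProfile_coordDistSq {0, 1} P a hδ0
  have hh2 : ∀ x, h x ∈ Icc (0 : ℝ) 1 := fun x =>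
    powerProfile_mem_Icc ha0 hδ0 (coordDistSq_nonneg _ P x)
  have hsm : ContDiff ℝ 1 fun x => 2 * (χ x * h x) := contDiff_const.mul (hχ.mul hh1)
  have hcs : HasCompactSupport fun x => 2 * (χ x * h x) := (h2.mul_right).mul_left
  -- The factor `2` makes the value on the segment strictly larger than `1`. Its square and `(a +
  -- b)² ≤ 2a² + 2b²` produce the `8` below, so each of the two terms costs at most `ε/2`.
  refine ⟨fun x => 2 * (χ x * h x), hsm, hcs, fun x =>
    mul_nonneg zero_le_two (mul_nonneg (h3 x).1 (hh2 x).1), fun x hx => ?_, ?_⟩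
  · have e1 : χ x = 1 := (h4 x hx).eq_of_nhds
    have e2 : coordDistSq {0, 1} P x = 0 := by
      simp [coordDistSq, hP, hx.1, hx.2.1]
    have e3 : h x = 1 := by simp [hh, e2, powerProfile, div_self (pow_pos hδ0 2).ne']
    simp only [e1, e3]
    norm_num
  · set G : ℝ → ℝ := fun s => 4 * a ^ 2 * powerProfile a δ s ^ 2 / (s + δ ^ 2) with hG
    have hCc : IsClosed C := by
      unfold C coordDistSq
      exact (isClosed_le (by fun_prop : Continuous fun x : Euc 3 =>
        ∑ j ∈ {0, 1}, (x j - P j) ^ 2) continuous_const).inter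
        (isClosed_Icc.preimage (by fun_prop : Continuous fun x : Euc 3 => x 2))
    have hCb : Bornology.IsBounded C := by
      refine Metric.isBounded_closedBall.subset (s := C) (t := Metric.closedBall P (3 * R)) ?_
      rintro x ⟨hx, hx2⟩
      have e2 : P 2 = 0 := by simp [hP]
      have hq : coordDistSq {0, 1} P x = (x 0 - P 0) ^ 2 + (x 1 - P 1) ^ 2 := by
        simp [coordDistSq]
      rw [Metric.mem_closedBall, EuclideanSpace.dist_eq, Real.sqrt_le_left (by positivity)]
      simp only [Fin.sum_univ_three, Real.dist_eq, sq_abs, e2, sub_zero]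
      rw [← hq]
      nlinarith [sq_le_sq' hx2.1 hx2.2]
    have hGc : Continuous fun x => G (coordDistSq {0, 1} P x) := by
      refine Continuous.div (continuous_const.mul (hh1.continuous.pow 2)) ?_ fun x => ?_
      · unfold coordDistSq
        fun_prop
      · exact (add_pos_of_nonneg_of_pos (coordDistSq_nonneg _ P x) (by positivity)).ne'
    have hGi : IntegrableOn (fun x => G (coordDistSq {0, 1} P x)) C :=
      hGc.continuousOn.integrableOn_compact (Metric.isCompact_of_isClosed_isBounded hCc hCb)
    have hGI := (integrable_indicator_iff hCc.measurableSet).2 hGi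
    have hGle : ∫ x in C, G (coordDistSq {0, 1} P x) ≤ ε / 16 := by
      rw [hC, setIntegral_cylinder P (by positivity) (by linarith)]
      have := integral_powerProfile_le (R := 2 * R) ha0 hδ0
      calc _ ≤ (R - -R) * (2 * Real.pi * a) := by
            refine mul_le_mul_of_nonneg_left ?_ (by linarith)
            exact mul_le_mul_of_nonneg_left this (by positivity)
        _ = ε / 16 := by rw [ha]; field_simp; norm_num
    have hI2 : Integrable fun x => h x ^ 2 * ‖fderiv ℝ χ x‖ ^ 2 :=
      ((hh1.continuous.pow 2).mul
        ((hχ.continuous_fderiv one_ne_zero).norm.pow 2)).integrable_of_hasCompactSupport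
        (hasCompactSupport_norm_fderiv_sq h2).mul_left
    have hbound : ∀ x, ‖fderiv ℝ (fun x => 2 * (χ x * h x)) x‖ ^ 2 ≤
        8 * C.indicator (fun x => G (coordDistSq {0, 1} P x)) x +
          8 * (h x ^ 2 * ‖fderiv ℝ χ x‖ ^ 2) := by
      intro x
      have dχ := hχ.differentiable one_ne_zero x
      have dh := hh1.differentiable one_ne_zero x
      rw [fderiv_const_mul (dχ.fun_mul dh), fderiv_fun_mul dχ dh, norm_smul, mul_pow]
      have n1 : ‖χ x • fderiv ℝ h x‖ ^ 2 ≤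
          C.indicator (fun x => G (coordDistSq {0, 1} P x)) x := by
        by_cases hx : x ∈ C
        · rw [indicator_of_mem hx, norm_smul, mul_pow, Real.norm_of_nonneg (h3 x).1]
          exact (mul_le_of_le_one_left (sq_nonneg _) (pow_le_one₀ (h3 x).1 (h3 x).2)).trans
            (norm_fderiv_powerProfile_sq_le {0, 1} P a hδ0 x)
        · simp [hsupp x hx, indicator_of_notMem hx]
      have n2 : ‖h x • fderiv ℝ χ x‖ ^ 2 = h x ^ 2 * ‖fderiv ℝ χ x‖ ^ 2 := by
        rw [norm_smul, mul_pow, Real.norm_eq_abs, sq_abs]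
      have n3 := pow_le_pow_left₀ (norm_nonneg _)
        (norm_add_le (χ x • fderiv ℝ h x) (h x • fderiv ℝ χ x)) 2
      have n4 := sq_nonneg (‖χ x • fderiv ℝ h x‖ - ‖h x • fderiv ℝ χ x‖)
      rw [Real.norm_of_nonneg zero_le_two]
      nlinarith
    refine (integral_mono (integrable_norm_fderiv_sq hsm hcs)
      ((hGI.const_mul 8).add (hI2.const_mul 8)) hbound).trans ?_
    simp only [Pi.add_apply]
    rw [integral_add (hGI.const_mul 8) (hI2.const_mul 8), integral_const_mul, integral_const_mul,
      integral_indicator hCc.measurableSet]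
    linarith

/-- A neighbourhood of the limit segment contains all but finitely many of the segments. -/
theorem exists_segmentTail_subset {α : ℝ} (hα : 0 < α) {U : Set (Euc 3)} (hU : IsOpen U)
    (h : unitSegment 0 ⊆ U) : ∃ m : ℕ, segmentTail α m ⊆ U := by
  -- The tails are decreasing compact sets whose intersection lies in the limit segment, because
  -- `n^(-α) → 0`.
  refine exists_subset_nhds_of_isCompact (V := segmentTail α) ?_
    (fun m => isCompact_segmentTail hα m) fun x hx => hU.mem_nhds (h ?_)
  · refine directed_of_isDirected_le fun i j hij x hx => ?_
    obtain ⟨⟨n, hn, e⟩ | e, e'⟩ := hx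
    · exact ⟨Or.inl ⟨n, hij.trans hn, e⟩, e'⟩
    · exact ⟨Or.inr e, e'⟩
  · rw [mem_iInter] at hx
    have ht := (tendsto_rpow_neg_atTop hα).comp tendsto_natCast_atTop_atTop
    have h0 : 0 ≤ x 0 := by
      rcases (hx 0).1 with ⟨n, -, e⟩ | e
      · rw [e]; positivity
      · exact e.ge
    refine ⟨le_antisymm (le_of_not_gt fun hpos => ?_) h0, (hx 0).2⟩
    obtain ⟨N, hN⟩ := (Filter.eventually_atTop.1 (ht.eventually (gt_mem_nhds hpos)))
    rcases (hx N).1 with ⟨n, hn, e⟩ | e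
    · exact (hN n hn).ne e.symm
    · exact hpos.ne' e

theorem exists_segmentSet_subset_union_segmentTail (α : ℝ) (m : ℕ) :
    ∃ F : Set (Euc 3), (∀ ε : ℝ, 0 < ε → HasEnergyLE F ε) ∧
      segmentSet α ⊆ F ∪ segmentTail α m := by
  induction m with
  | zero =>
    -- The tail from `0` already contains everything; any `F` of arbitrarily small energy would do
    -- here.
    refine ⟨unitSegment 0, fun ε hε => hasEnergyLE_unitSegment 0 hε, fun x hx => Or.inr ?_⟩
    obtain ⟨⟨n, -, e⟩ | e, e'⟩ := hx
    · exact ⟨Or.inl ⟨n, n.zero_le, e⟩, e'⟩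
    · exact ⟨Or.inr e, e'⟩
  | succ m ih =>
    obtain ⟨F, hF, hsub⟩ := ih
    refine ⟨F ∪ unitSegment ((m : ℝ) ^ (-α)), fun ε hε => ?_, ?_⟩
    · have := (hF (ε / 4) (by positivity)).union
        (hasEnergyLE_unitSegment ((m : ℝ) ^ (-α)) (by positivity : 0 < ε / 4))
      rwa [mul_div_cancel₀ _ four_ne_zero] at this
    · rwa [segmentTail_eq_union, ← union_assoc] at hsub

/-- The number `m` of exceptional segments depends on `ε` through `u`, but their union `F` has
energy below every positive bound, so `m` does not enter the estimate. -/
theorem hasEnergyLE_segmentSet {α : ℝ} (hα : 0 < α) {ε : ℝ} (hε : 0 < ε) :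
    HasEnergyLE (segmentSet α) ε := by
  have hε4 : 0 < ε / 4 := by positivity
  obtain ⟨u, hu, hc, h0, h1, hi⟩ := hasEnergyLE_unitSegment 0 hε4
  obtain ⟨m, hm⟩ := exists_segmentTail_subset hα (isOpen_lt continuous_const hu.continuous) h1
  obtain ⟨F, hF, hsub⟩ := exists_segmentSet_subset_union_segmentTail α m
  obtain ⟨v, kv, kc, k0, k1, ki⟩ := (hF (ε / 4) hε4).union
    (show HasEnergyLE (segmentTail α m) (ε / 4) from ⟨u, hu, hc, h0, hm, hi⟩)
  rw [mul_div_cancel₀ _ four_ne_zero] at ki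
  exact ⟨v, kv, kc, k0, fun x hx => k1 x (hsub hx), ki⟩

/-! ### Conclusion -/

theorem segmentSet_subset_unitCube {α : ℝ} (hα : 0 < α) :
    ∀ x ∈ segmentSet α, ∀ i, x i ∈ Set.Icc (0 : ℝ) 1 := by
  rintro x ⟨h0, h1, h2⟩ i
  have h0' : x 0 ∈ Icc (0 : ℝ) 1 := by
    rcases h0 with ⟨n, hn, e⟩ | e
    · rw [e]
      exact ⟨by positivity, Real.rpow_le_one_of_one_le_of_nonpos (by exact_mod_cast hn)
        (by linarith)⟩
    · simp [e]
  fin_cases i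
  · exact h0'
  · simp [h1]
  · exact h2

theorem proposition1 (α : ℝ) (hα : 0 < α) :
    (IsCompact (segmentSet α) ∧
      (∀ x ∈ segmentSet α, ∀ i, x i ∈ Set.Icc (0 : ℝ) 1) ∧
      newtonianCapacity (segmentSet α) = 0) ∧
    (AEMeasurable (fun r : ℝ => (perimeter (Metric.cthickening r (segmentSet α)))⁻¹)
        (volume.restrict (Set.Ioi (0 : ℝ))) ∧
      ENNReal.ofReal (4 * Real.pi * α / ((2 : ℝ) ^ (α + 2) + 3 * α * (α + 1)))
        ≤ (invPerimeterIntegral (segmentSet α))⁻¹ ∧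
      0 < 4 * Real.pi * α / ((2 : ℝ) ^ (α + 2) + 3 * α * (α + 1))) ∧
    (filledHull (segmentSet α) = segmentSet α ∧
      invPerimeterIntegral (filledHull (segmentSet α)) < ⊤ ∧
      newtonianCapacity (segmentSet α) <
        (invPerimeterIntegral (filledHull (segmentSet α)))⁻¹) := by
  have hcap : newtonianCapacity (segmentSet α) = 0 :=
    newtonianCapacity_eq_zero_of_hasEnergyLE fun ε hε => hasEnergyLE_segmentSet hα hε
  have hle := invPerimeterIntegral_segmentSet_le hα
  have hlt : invPerimeterIntegral (segmentSet α) < ⊤ := hle.trans_lt ENNReal.ofReal_lt_top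
  refine ⟨⟨isCompact_segmentTail hα 1, segmentSet_subset_unitCube hα, hcap⟩,
    ⟨(aemeasurable_perimeter_cthickening fun r hr => volume_cthickening_segmentSet_diff hα hr).inv,
      ?_, by positivity⟩, filledHull_segmentSet α, ?_, ?_⟩
  · rw [← inv_div, ENNReal.ofReal_inv_of_pos (by positivity)]
    exact ENNReal.inv_le_inv.2 hle
  · rwa [filledHull_segmentSet]
  · rw [filledHull_segmentSet, hcap]
    exact ENNReal.inv_pos.2 hlt.ne
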